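/- **Setting.** Let $V$ be a finite-dimensional complex vector space with a real form $V_{\mathbb R}$ and complex conjugation $v\mapsto\bar v$, let $W$ be a finite increasing filtration of $V$ defined over $\mathbb R$, and for each $k$ let $Q_k$ be a non-degenerate real bilinear form on $Gr^W_k=W_k/W_{k-1}$ of parity $(-1)^k$. Fix Hodge numbers $h^{p,q}$ and let $\mathcal M$ be the classifying space of all decreasing filtrations $F$ of $V$ such that $(F,W)$ is a mixed Hodge structure, graded-polarized by $Q=\{Q_k\}$, with graded Hodge numbers $h^{p,q}$. For $F\in\mathcal M$ let $V=\bigoplus I^{p,q}_{(F,W)}$ be the Deligne bigrading, $$I^{p,q}=F^p\cap W_{p+q}\cap\Bigl(\bar F^q\cap W_{p+q}+\sum_{j>0}\bar F^{q-j}\cap W_{p+q-1-j}\Bigr),$$ and let $\mathcal M_{\mathbb R}\subseteq\mathcal M$ be the set of those $F$ for which $(F,W)$ is split over $\mathbb R$, i.e. $\overline{I^{p,q}}=I^{q,p}$ for all $p,q$. Let $G_{\mathbb C}$ be the group of all $g\in GL(V)$ which stabilize $W$ and act on $Gr^W$ by complex isometries of $Q$, let $G\subseteq G_{\mathbb C}$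 be the subgroup of those which act on $Gr^W$ by real isometries of $Q$, and let $H\subseteq G$ be the subgroup of those which induce real automorphisms of $W_k/W_{k-2}$ for all $k$. Put $\mathfrak g_{\mathbb C}=Lie(G_{\mathbb C})$ and $\mathfrak h=Lie(H)$. Fix $F_o\in\mathcal M_{\mathbb R}$, let $\check{\mathcal M}=G_{\mathbb C}.F_o$, and let $\mathfrak g^{r,s}$ be the set of $\alpha\in\mathfrak g_{\mathbb C}$ with $\alpha(I^{p,q}_{(F_o,W)})\subseteq I^{p+r,q+s}_{(F_o,W)}$ for all $p,q$. Then $\mathfrak g_{\mathbb C}=\eta_+\oplus\eta_0\oplus\eta_-\oplus\Lambda$, where $$\eta_+=\bigoplus_{r\ge0,\,s<0}\mathfrak g^{r,s},\quad \eta_0=\mathfrak g^{0,0},\quad \eta_-=\bigoplus_{r<0,\,s\ge0}\mathfrak g^{r,s},\quad \Lambda=\bigoplus_{r,s<0}\mathfrak g^{r,s}.$$ Let $\mathrm L$ be the linear operator which is $+i$ on $\eta_+$, $0$ on $\eta_0$, and $-i$ on $\eta_-\oplus\Lambda$ (it preserves $\mathfrak h$). **Theorem 7.1.** Let $F_o\in\mathcal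 M_{\mathbb R}$, let $J\subseteq\mathbb R$ be an open interval, and let $\beta:J\to\mathfrak h$ be a differentiable function which satisfies the Lax equation $$\frac{d\beta}{dy}=-[\beta(y),\mathrm L\beta(y)]\qquad(y\in J).$$ Then there exist a differentiable $H$-valued function $h(y)$ on $J$, an element $\tilde N\in\mathfrak h$ and a point $\tilde F\in\check{\mathcal M}$ such that for all $y\in J$: (a) $h^{-1}(y)\dfrac{dh}{dy}=-\mathrm L\beta(y)$ and $\beta(y)=\mathrm{Ad}(h^{-1}(y))\tilde N$; (b) $h(y).F_o=e^{iy\tilde N}.\tilde F$. -/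

import Mathlib

noncomputable section

namespace MixedHodge

/-- The linear data underlying a classifying space of graded-polarized mixed Hodge structures: a
finite-dimensional complex vector space `V` with a real structure (given by complex conjugation
`conj`, whose fixed space is the real form of `V`), a finite increasing filtration `W` defined over
the reals, and, for every `k`, a non-degenerate real bilinear form `Q k` of parity `(-1) ^ k` on
`W k / W (k - 1)`.  The norm of `V` only serves to have a topology at hand. -/
structure Data (V : Type*) [NormedAddCommGroup V] [NormedSpace ℂ V] where
  /-- complex conjugation with respect to the real form -/
  conj : V →ₛₗ[starRingEnd ℂ] V
  conj_conj : ∀ v, conj (conj v) = v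
  /-- the weight filtration -/
  W : ℤ → Submodule ℂ V
  W_mono : Monotone W
  W_bot : ∃ k, W k = ⊥
  W_top : ∃ k, W k = ⊤
  W_real : ∀ k, ∀ v ∈ W k, conj v ∈ W k
  /-- the graded polarizations -/
  Q : ∀ k, LinearMap.BilinForm ℂ (W k ⧸ (W (k - 1)).submoduleOf (W k))
  Q_nondegenerate : ∀ k, (Q k).Nondegenerate
  Q_parity : ∀ k x y, Q k x y = (-1 : ℂ) ^ k * Q k y x
  Q_real : ∀ k (u v u' v' : W k), (u' : V) = conj u → (v' : V) = conj v →
    Q k (Submodule.Quotient.mk u') (Submodule.Quotient.mk v') =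
      starRingEnd ℂ (Q k (Submodule.Quotient.mk u) (Submodule.Quotient.mk v))

/-- A family of subspaces of `V` indexed by the integers (a filtration, once it is antitone). -/
abbrev Fil (V : Type*) [NormedAddCommGroup V] [NormedSpace ℂ V] := ℤ → Submodule ℂ V

/-- The filtration `g.F`, with members `g (F p)`. -/
def act {V : Type*} [NormedAddCommGroup V] [NormedSpace ℂ V] (g : V →L[ℂ] V) (F : Fil V) :
    Fil V :=
  fun p => (F p).map (g : V →ₗ[ℂ] V)

namespace Data

variable {V : Type*} [NormedAddCommGroup V] [NormedSpace ℂ V] (D : Data V)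

/-- The graded quotient `W k / W (k - 1)`. -/
abbrev Gr (k : ℤ) : Type _ := D.W k ⧸ (D.W (k - 1)).submoduleOf (D.W k)

/-- The class in `Gr k` of a vector of `W k`. -/
abbrev cls {k : ℤ} (u : D.W k) : D.Gr k := Submodule.Quotient.mk u

/-- The subspace of `Gr k` induced by a subspace `S` of `V`: the image of `S ∩ W k`. -/
def grSub (k : ℤ) (S : Submodule ℂ V) : Submodule ℂ (D.Gr k) :=
  (S.submoduleOf (D.W k)).map ((D.W (k - 1)).submoduleOf (D.W k)).mkQ

/-- The conjugate filtration of `F`. -/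
def conjFil (F : Fil V) : Fil V := fun p => (F p).map D.conj

/-- The summand `H^{p,q}` of the Hodge structure of weight `p + q` induced by `F` on
`Gr (p + q)`. -/
def hodgePart (F : Fil V) (p q : ℤ) : Submodule ℂ (D.Gr (p + q)) :=
  D.grSub (p + q) (F p) ⊓ D.grSub (p + q) (D.conjFil F q)

/-- `(F, W)` is a mixed Hodge structure: `F` is a finite decreasing filtration which induces on
every `Gr k` a pure Hodge structure of weight `k`. -/
structure IsMHS (F : Fil V) : Prop where
  antitone : Antitone F
  exhaustive : ∃ p, F p = ⊤
  separated : ∃ p, F p = ⊥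
  isCompl : ∀ k p, IsCompl (D.grSub k (F p)) (D.grSub k (D.conjFil F (k + 1 - p)))

/-- `(F, W)` is graded-polarized by `Q`: the two Hodge-Riemann bilinear relations on each `Gr k`. -/
structure IsPolarized (F : Fil V) : Prop where
  orthogonal : ∀ k p, ∀ x ∈ D.grSub k (F p), ∀ y ∈ D.grSub k (F (k + 1 - p)), D.Q k x y = 0
  positive : ∀ p q, ∀ u u' : D.W (p + q), (u' : V) = D.conj u →
    D.cls u ∈ D.hodgePart F p q → D.cls u ≠ 0 →
    ∃ r : ℝ, 0 < r ∧ Complex.I ^ (p - q) * D.Q (p + q) (D.cls u) (D.cls u') = r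

/-- The classifying space `M` of mixed Hodge structures `(F, W)` on `V` which are graded-polarized
by `Q` and have Hodge numbers `hn p q = dim H^{p,q}`. -/
def M (hn : ℤ → ℤ → ℕ) : Set (Fil V) :=
  {F | D.IsMHS F ∧ D.IsPolarized F ∧ ∀ p q, Module.finrank ℂ (D.hodgePart F p q) = hn p q}

/-- The summand `I^{p,q}` of the Deligne bigrading of `(F, W)`. -/
def I (F : Fil V) (p q : ℤ) : Submodule ℂ V :=
  F p ⊓ D.W (p + q) ⊓
    (D.conjFil F q ⊓ D.W (p + q) ⊔
      ⨆ (j : ℤ) (_ : 0 < j), D.conjFil F (q - j) ⊓ D.W (p + q - 1 - j))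

/-- The locus of those `F` in `M` for which `(F, W)` is split over the reals. -/
def MR (hn : ℤ → ℤ → ℕ) : Set (Fil V) :=
  {F | F ∈ D.M hn ∧ ∀ p q, (D.I F p q).map D.conj = D.I F q p}

/-- The complex group of all `g` in `GL(V)` which stabilize `W` and induce isometries of the forms
`Q k` on the graded quotients. -/
def GC : Set (V →L[ℂ] V)ˣ :=
  {g | (∀ k, (D.W k).map ((g : V →L[ℂ] V) : V →ₗ[ℂ] V) = D.W k) ∧
    ∀ k (u v u' v' : D.W k), (u' : V) = (g : V →L[ℂ] V) u → (v' : V) = (g : V →L[ℂ] V) v →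
      D.Q k (D.cls u') (D.cls v') = D.Q k (D.cls u) (D.cls v)}

/-- The group `G` of all `g` in `GL(V)` which stabilize `W` and induce real isometries of the forms
`Q k` on the graded quotients. -/
def G : Set (V →L[ℂ] V)ˣ :=
  {g | g ∈ D.GC ∧ ∀ k, ∀ v ∈ D.W k,
    D.conj ((g : V →L[ℂ] V) v) - (g : V →L[ℂ] V) (D.conj v) ∈ D.W (k - 1)}

/-- The group `H` of those `g` in `G` which induce real automorphisms of all the quotients
`W k / W (k - 2)`. -/
def H : Set (V →L[ℂ] V)ˣ :=
  {g | g ∈ D.G ∧ ∀ k, ∀ v ∈ D.W k,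
    D.conj ((g : V →L[ℂ] V) v) - (g : V →L[ℂ] V) (D.conj v) ∈ D.W (k - 2)}

/-- The orbit of `F` under the complex group; for `F` in `M` this is the compact dual of `M`. -/
def Mcheck (F : Fil V) : Set (Fil V) := {F' | ∃ g ∈ D.GC, F' = act (g : V →L[ℂ] V) F}

/-- The Lie algebra of the complex group: the endomorphisms which preserve `W` and induce
infinitesimal isometries of the forms `Q k`. -/
def lieGC : Submodule ℂ (V →L[ℂ] V) where
  carrier := {a | (∀ k, ∀ v ∈ D.W k, a v ∈ D.W k) ∧
    ∀ k (u v u' v' : D.W k), (u' : V) = a u → (v' : V) = a v →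
      D.Q k (D.cls u') (D.cls v) + D.Q k (D.cls u) (D.cls v') = 0}
  zero_mem' := by
    refine ⟨fun k v _ => by simp, fun k u v u' v' hu hv => ?_⟩
    have h1 : u' = 0 := Subtype.ext (by simpa using hu)
    have h2 : v' = 0 := Subtype.ext (by simpa using hv)
    subst h1 h2
    simp [cls]
  add_mem' := by
    rintro a b ⟨ha, ha'⟩ ⟨hb, hb'⟩
    refine ⟨fun k v hv => (D.W k).add_mem (ha k v hv) (hb k v hv), fun k u v u' v' hu hv => ?_⟩
    have h1 : u' = ⟨a u, ha k u u.2⟩ + ⟨b u, hb k u u.2⟩ := Subtype.ext (by simpa using hu)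
    have h2 : v' = ⟨a v, ha k v v.2⟩ + ⟨b v, hb k v v.2⟩ := Subtype.ext (by simpa using hv)
    have e1 := ha' k u v ⟨a u, ha k u u.2⟩ ⟨a v, ha k v v.2⟩ rfl rfl
    have e2 := hb' k u v ⟨b u, hb k u u.2⟩ ⟨b v, hb k v v.2⟩ rfl rfl
    subst h1 h2
    simp only [cls, Submodule.Quotient.mk_add, map_add, LinearMap.add_apply] at e1 e2 ⊢
    linear_combination e1 + e2
  smul_mem' := by
    rintro c a ⟨ha, ha'⟩
    refine ⟨fun k v hv => (D.W k).smul_mem c (ha k v hv), fun k u v u' v' hu hv => ?_⟩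
    have h1 : u' = c • ⟨a u, ha k u u.2⟩ := Subtype.ext (by simpa using hu)
    have h2 : v' = c • ⟨a v, ha k v v.2⟩ := Subtype.ext (by simpa using hv)
    have e1 := ha' k u v ⟨a u, ha k u u.2⟩ ⟨a v, ha k v v.2⟩ rfl rfl
    subst h1 h2
    simp only [cls, Submodule.Quotient.mk_smul, map_smul, LinearMap.smul_apply, smul_eq_mul]
      at e1 ⊢
    linear_combination c * e1

/-- The Lie algebra of `H`: those members of the Lie algebra of the complex group which induce real
endomorphisms of all the quotients `W k / W (k - 2)`. -/
def lieH : Submodule ℝ (V →L[ℂ] V) where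
  carrier := {a | a ∈ D.lieGC ∧ ∀ k, ∀ v ∈ D.W k, D.conj (a v) - a (D.conj v) ∈ D.W (k - 2)}
  zero_mem' := ⟨D.lieGC.zero_mem, fun k v _ => by simp⟩
  add_mem' := by
    rintro a b ⟨ha, ha'⟩ ⟨hb, hb'⟩
    refine ⟨D.lieGC.add_mem ha hb, fun k v hv => ?_⟩
    have := (D.W (k - 2)).add_mem (ha' k v hv) (hb' k v hv)
    simpa [add_sub_add_comm] using this
  smul_mem' := by
    rintro c a ⟨ha, ha'⟩
    refine ⟨D.lieGC.smul_mem (c : ℂ) ha, fun k v hv => ?_⟩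
    have := (D.W (k - 2)).smul_mem (c : ℂ) (ha' k v hv)
    have e : D.conj ((c • a) v) - (c • a) (D.conj v) =
        (c : ℂ) • (D.conj (a v) - a (D.conj v)) := by
      change D.conj ((c : ℂ) • a v) - (c : ℂ) • a (D.conj v) = _
      rw [LinearMap.map_smulₛₗ, Complex.conj_ofReal, smul_sub]
    rwa [e]

section LieAlgebras

/-! `lieGC` and `lieH` are the Lie algebras of `GC` and `H` in the sense of one-parameter groups. -/

variable [FiniteDimensional ℂ V]

theorem exp_mem_of_pow_mem (S : Submodule ℝ (V →L[ℂ] V)) (a : V →L[ℂ] V) (h : ∀ n : ℕ, a ^ n ∈ S)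
    (t : ℝ) : NormedSpace.exp (t • a) ∈ S := by
  have : FiniteDimensional ℝ (V →L[ℂ] V) := FiniteDimensional.complexToReal _
  have : CompleteSpace (V →L[ℂ] V) := FiniteDimensional.complete ℂ _
  have hc : IsClosed (S : Set (V →L[ℂ] V)) := S.closed_of_finiteDimensional
  have hs := NormedSpace.exp_series_hasSum_exp' (𝕂 := ℝ) (t • a)
  refine hc.mem_of_tendsto hs (Filter.Eventually.of_forall fun s => ?_)
  refine S.sum_mem fun n _ => S.smul_mem _ ?_
  rw [smul_pow]
  exact S.smul_mem _ (h n)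

theorem mem_of_exp_mem (S : Submodule ℝ (V →L[ℂ] V)) (a : V →L[ℂ] V)
    (h : ∀ t : ℝ, NormedSpace.exp (t • a) ∈ S) : a ∈ S := by
  have : FiniteDimensional ℝ (V →L[ℂ] V) := FiniteDimensional.complexToReal _
  have : CompleteSpace (V →L[ℂ] V) := FiniteDimensional.complete ℂ _
  have hc : IsClosed (S : Set (V →L[ℂ] V)) := S.closed_of_finiteDimensional
  have hd := hasDerivAt_exp_smul_const (𝕂 := ℝ) a (0 : ℝ)
  rw [hasDerivAt_iff_tendsto_slope] at hd
  simp at hd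
  refine hc.mem_of_tendsto hd (Filter.Eventually.of_forall fun s => ?_)
  simp only [slope, vsub_eq_sub]
  exact S.smul_mem _ (S.sub_mem (h s) (by simpa using h 0))

/-- The operators which map `P` to `Q`. -/
def stab (P Q : Submodule ℂ V) : Submodule ℝ (V →L[ℂ] V) where
  carrier := {b | ∀ v ∈ P, b v ∈ Q}
  zero_mem' := fun v _ => by simp
  add_mem' := fun ha hb v hv => Q.add_mem (ha v hv) (hb v hv)
  smul_mem' := fun c a ha v hv => Q.smul_mem (c : ℂ) (ha v hv)

/-- The operators which commute with the conjugation on `P` modulo `Q`. -/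
def real (P Q : Submodule ℂ V) : Submodule ℝ (V →L[ℂ] V) where
  carrier := {b | ∀ v ∈ P, D.conj (b v) - b (D.conj v) ∈ Q}
  zero_mem' := fun v _ => by simp
  add_mem' := fun {a b} ha hb v hv => by
    simpa [add_sub_add_comm] using Q.add_mem (ha v hv) (hb v hv)
  smul_mem' := fun c a ha v hv => by
    have e : D.conj ((c • a) v) - (c • a) (D.conj v) =
        (c : ℂ) • (D.conj (a v) - a (D.conj v)) := by
      change D.conj ((c : ℂ) • a v) - (c : ℂ) • a (D.conj v) = _
      rw [LinearMap.map_smulₛₗ, Complex.conj_ofReal, smul_sub]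
    rw [e]; exact Q.smul_mem (c : ℂ) (ha v hv)

theorem exists_form (k : ℤ) : ∃ B : V →L[ℂ] V →L[ℂ] ℂ, ∀ u v : D.W k,
    B u v = D.Q k (D.cls u) (D.cls v) := by
  obtain ⟨P, hP⟩ := (D.W k).subtype.exists_leftInverse_of_injective (by simp)
  have hP' : ∀ u : D.W k, P u = u := fun u => LinearMap.congr_fun hP u
  let q := ((D.W (k - 1)).submoduleOf (D.W k)).mkQ ∘ₗ P
  refine ⟨((D.Q k).compl₁₂ q q).toContinuousBilinearMap, fun u v => ?_⟩
  simp [q, hP', cls]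

theorem hasDerivAt_exp_apply (a : V →L[ℂ] V) (t : ℝ) (u : V) :
    HasDerivAt (fun t : ℝ => (NormedSpace.exp (t • a) : V →L[ℂ] V) u)
      (a ((NormedSpace.exp (t • a) : V →L[ℂ] V) u)) t := by
  have : CompleteSpace (V →L[ℂ] V) := FiniteDimensional.complete ℂ _
  have h := hasDerivAt_exp_smul_const' (𝕂 := ℝ) a t
  exact ((ContinuousLinearMap.apply ℂ V u).restrictScalars ℝ).hasFDerivAt.comp_hasDerivAt t h

theorem hasDerivAt_form (B : V →L[ℂ] V →L[ℂ] ℂ) (a : V →L[ℂ] V) (t : ℝ) (u v : V) :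
    HasDerivAt (fun t : ℝ => B ((NormedSpace.exp (t • a) : V →L[ℂ] V) u)
        ((NormedSpace.exp (t • a) : V →L[ℂ] V) v))
      (B ((NormedSpace.exp (t • a) : V →L[ℂ] V) u) (a ((NormedSpace.exp (t • a) : V →L[ℂ] V) v)) +
       B (a ((NormedSpace.exp (t • a) : V →L[ℂ] V) u)) ((NormedSpace.exp (t • a) : V →L[ℂ] V) v))
      t :=
  (B.bilinearRestrictScalars ℝ).hasDerivAt_of_bilinear (fun _ => hasDerivAt_exp_apply a t u)
    (fun _ => hasDerivAt_exp_apply a t v)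

/-- `lieGC` is the Lie algebra of the linear group `GC`. -/
theorem mem_lieGC_iff_exp (a : V →L[ℂ] V) :
    a ∈ D.lieGC ↔ ∀ t : ℝ, ∃ g ∈ D.GC, (g : V →L[ℂ] V) = NormedSpace.exp (t • a) := by
  have : CompleteSpace (V →L[ℂ] V) := FiniteDimensional.complete ℂ _
  constructor
  · rintro ⟨ha, ha'⟩ t
    have hW : ∀ t : ℝ, ∀ k, ∀ v ∈ D.W k, (NormedSpace.exp (t • a) : V →L[ℂ] V) v ∈ D.W k := by
      intro t k
      refine exp_mem_of_pow_mem (stab (D.W k) (D.W k)) a (fun n => ?_) t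
      induction n with
      | zero => exact fun v hv => by simpa using hv
      | succ n ih =>
        intro v hv
        rw [pow_succ']
        exact ha k _ (ih v hv)
    have he : ∀ t : ℝ, (NormedSpace.exp (t • a) : V →L[ℂ] V) * NormedSpace.exp ((-t) • a) = 1 := by
      intro t
      let : NormedAlgebra ℚ (V →L[ℂ] V) := NormedAlgebra.restrictScalars ℚ ℂ _
      rw [← NormedSpace.exp_add_of_commute (((Commute.refl a).smul_left t).smul_right (-t))]
      simp
    let g : (V →L[ℂ] V)ˣ := ⟨NormedSpace.exp (t • a), NormedSpace.exp ((-t) • a), he t, by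
      simpa using he (-t)⟩
    refine ⟨g, ⟨fun k => ?_, ?_⟩, rfl⟩
    · refine le_antisymm ?_ fun v hv => ⟨_, hW (-t) k v hv, ?_⟩
      · rintro _ ⟨v, hv, rfl⟩
        exact hW t k v hv
      · exact congrArg (fun f : V →L[ℂ] V => f v) (he t)
    · intro k u v u' v' hu hv
      obtain ⟨B, hB⟩ := D.exists_form k
      have hc := is_const_of_deriv_eq_zero (𝕜 := ℝ)
        (fun t => (hasDerivAt_form B a t u v).differentiableAt)
        (fun t => by
          rw [(hasDerivAt_form B a t u v).deriv]
          have := ha' k ⟨_, hW t k u u.2⟩ ⟨_, hW t k v v.2⟩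
            ⟨_, ha k _ (hW t k u u.2)⟩ ⟨_, ha k _ (hW t k v v.2)⟩ rfl rfl
          rw [← hB, ← hB] at this
          rw [add_comm]; exact this) t 0
      rw [← hB, ← hB, hu, hv]
      simpa using hc
  · intro h
    have hW : ∀ t : ℝ, ∀ k, ∀ v ∈ D.W k, (NormedSpace.exp (t • a) : V →L[ℂ] V) v ∈ D.W k := by
      intro t k v hv
      obtain ⟨g, hg, e⟩ := h t
      rw [← e, ← hg.1 k]; exact ⟨v, hv, rfl⟩
    refine ⟨fun k => mem_of_exp_mem (stab (D.W k) (D.W k)) a (fun t => hW t k), ?_⟩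
    intro k u v u' v' hu hv
    obtain ⟨B, hB⟩ := D.exists_form k
    have h1 := hasDerivAt_form B a 0 u v
    have h2 : (fun t : ℝ => B ((NormedSpace.exp (t • a) : V →L[ℂ] V) u)
        ((NormedSpace.exp (t • a) : V →L[ℂ] V) v)) = fun _ => B u v := by
      funext t
      obtain ⟨g, hg, e⟩ := h t
      have := hg.2 k u v ⟨_, hW t k u u.2⟩ ⟨_, hW t k v v.2⟩ (by rw [e]) (by rw [e])
      rwa [← hB, ← hB] at this
    rw [h2] at h1
    have h3 := h1.unique (hasDerivAt_const _ _)
    rw [← hB, ← hB, hu, hv, add_comm]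
    simpa using h3

/-- `lieH` is the Lie algebra of the linear group `H`. -/
theorem mem_lieH_iff_exp (a : V →L[ℂ] V) :
    a ∈ D.lieH ↔ ∀ t : ℝ, ∃ g ∈ D.H, (g : V →L[ℂ] V) = NormedSpace.exp (t • a) := by
  constructor
  · rintro ⟨ha, ha'⟩ t
    obtain ⟨g, hg, e⟩ := (D.mem_lieGC_iff_exp a).1 ha t
    have h2 : ∀ k, ∀ v ∈ D.W k,
        D.conj ((g : V →L[ℂ] V) v) - (g : V →L[ℂ] V) (D.conj v) ∈ D.W (k - 2) := by
      intro k
      rw [e]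
      refine exp_mem_of_pow_mem (D.real (D.W k) (D.W (k - 2))) a (fun n => ?_) t
      suffices h : (∀ v ∈ D.W k, (a ^ n) v ∈ D.W k) ∧ a ^ n ∈ D.real (D.W k) (D.W (k - 2)) from h.2
      induction n with
      | zero => exact ⟨fun v hv => by simpa using hv, fun v hv => by simp⟩
      | succ n ih =>
        refine ⟨fun v hv => by rw [pow_succ']; exact ha.1 k _ (ih.1 v hv), fun v hv => ?_⟩
        have h1 := ha' k _ (ih.1 v hv)
        have h2 := ha.1 (k - 2) _ (ih.2 v hv)
        have := (D.W (k - 2)).add_mem h1 h2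
        rw [pow_succ']
        simpa using this
    exact ⟨g, ⟨⟨hg, fun k v hv => D.W_mono (by lia) (h2 k v hv)⟩, h2⟩, e⟩
  · intro h
    refine ⟨(D.mem_lieGC_iff_exp a).2 fun t => ?_, fun k => ?_⟩
    · obtain ⟨g, hg, e⟩ := h t
      exact ⟨g, hg.1.1, e⟩
    · refine mem_of_exp_mem (D.real (D.W k) (D.W (k - 2))) a fun t => ?_
      obtain ⟨g, hg, e⟩ := h t
      rw [← e]
      exact hg.2 k

end LieAlgebras

/-- The summand of type `(r, s)` of the bigrading which `(F, W)` induces on the Lie algebra of the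
complex group: the elements which map every `I^{p,q}` to `I^{p+r,q+s}`. -/
def g (F : Fil V) (r s : ℤ) : Submodule ℂ (V →L[ℂ] V) where
  carrier := {a | a ∈ D.lieGC ∧ ∀ p q, ∀ v ∈ D.I F p q, a v ∈ D.I F (p + r) (q + s)}
  zero_mem' := ⟨D.lieGC.zero_mem, fun p q v _ => by simp⟩
  add_mem' := by
    rintro a b ⟨ha, ha'⟩ ⟨hb, hb'⟩
    exact ⟨D.lieGC.add_mem ha hb, fun p q v hv =>
      (D.I F (p + r) (q + s)).add_mem (ha' p q v hv) (hb' p q v hv)⟩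
  smul_mem' := by
    rintro c a ⟨ha, ha'⟩
    exact ⟨D.lieGC.smul_mem c ha, fun p q v hv =>
      (D.I F (p + r) (q + s)).smul_mem c (ha' p q v hv)⟩

/-- `η₊`: the sum of the summands of type `(r, s)` with `r ≥ 0` and `s < 0`. -/
def etaPlus (F : Fil V) : Submodule ℂ (V →L[ℂ] V) :=
  ⨆ (r : ℤ) (s : ℤ) (_ : 0 ≤ r ∧ s < 0), D.g F r s

/-- `η₀`: the summand of type `(0, 0)`. -/
def etaZero (F : Fil V) : Submodule ℂ (V →L[ℂ] V) := D.g F 0 0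

/-- `η₋`: the sum of the summands of type `(r, s)` with `r < 0` and `s ≥ 0`. -/
def etaMinus (F : Fil V) : Submodule ℂ (V →L[ℂ] V) :=
  ⨆ (r : ℤ) (s : ℤ) (_ : r < 0 ∧ 0 ≤ s), D.g F r s

/-- `Λ`: the sum of the summands of type `(r, s)` with `r < 0` and `s < 0`. -/
def Lam (F : Fil V) : Submodule ℂ (V →L[ℂ] V) :=
  ⨆ (r : ℤ) (s : ℤ) (_ : r < 0 ∧ s < 0), D.g F r s

/-- `t = (a₊, a₀, a₋)` is the triple of components of `a` with respect to the decomposition of the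
Lie algebra of the complex group as the direct sum of `η₊`, `η₀` and `η₋ ⊕ Λ`. -/
def IsComponents (F : Fil V) (a : V →L[ℂ] V)
    (t : (V →L[ℂ] V) × (V →L[ℂ] V) × (V →L[ℂ] V)) : Prop :=
  t.1 ∈ D.etaPlus F ∧ t.2.1 ∈ D.etaZero F ∧ t.2.2 ∈ D.etaMinus F ⊔ D.Lam F ∧
    a = t.1 + t.2.1 + t.2.2

open Classical in
/-- The operator `L` on the Lie algebra of the complex group: `+i` on `η₊`, `0` on `η₀` and `-i` on
`η₋ ⊕ Λ`, that is, `L a = i a₊ - i a₋` in terms of the components of `a`.  (When `(F, W)` is a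
graded-polarized mixed Hodge structure, every member of the Lie algebra has exactly one triple of
components.  The value outside of the Lie algebra is irrelevant.) -/
def L (F : Fil V) (a : V →L[ℂ] V) : V →L[ℂ] V :=
  if h : ∃ t, D.IsComponents F a t then
    Complex.I • h.choose.1 - Complex.I • h.choose.2.2
  else 0

end Data

end MixedHodge

end

/-!
Let `u` solve `u' = (L β) u` with `u y₀ = 1` and put `h = u⁻¹`. As `β' = [L β, β]`, the conjugate
`u⁻¹ β u` is constant, equal to `N = β y₀`; this is (a). The operator `L β + i β` has no component
of degree `(r, s)` with `r < 0`, since `L` is `-i` there, so the solution `x` of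
`x' = (L β + i β) x` fixes `F₀`. On the other hand `u⁻¹ x` solves an equation with the constant
coefficient `u⁻¹ (i β) u = i N`, so `h.F₀ = u⁻¹ x.F₀ = exp (i (y - y₀) N).F₀`; this is (b).

That `u` stays in `H` rests on `L β` lying in its Lie algebra. In degree `(r, s)` the operator `L`
is multiplication by a scalar; those of `(r, s)` and `(s, r)` are complex conjugate unless both `r`
and `s` are negative, and such components vanish on all the quotients `W k / W (k - 2)`.
-/

noncomputable section

section PeanoBaker

variable {E : Type*} [NormedAddCommGroup E] [NormedSpace ℝ E]

/-- The terms of the Peano–Baker series, iterated integrals whose sum is the solution of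
`x' = A x` with `x t₀ = x₀`. -/
def peanoBaker (A : ℝ → E →L[ℝ] E) (t₀ : ℝ) (x₀ : E) : ℕ → ℝ → E
  | 0 => fun _ => x₀
  | n + 1 => fun t => ∫ s in t₀..t, A s (peanoBaker A t₀ x₀ n s)

variable {A : ℝ → E →L[ℝ] E} {J : Set ℝ} {t₀ : ℝ}

theorem peanoBaker_succ_self (x₀ : E) (n : ℕ) : peanoBaker A t₀ x₀ (n + 1) t₀ = 0 :=
  intervalIntegral.integral_same

theorem norm_peanoBaker_le (hJ : J.OrdConnected) {K : ℝ} (hK : ∀ t ∈ J, ‖A t‖ ≤ K) (ht₀ : t₀ ∈ J)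
    (x₀ : E) (n : ℕ) {t : ℝ} (ht : t ∈ J) :
    ‖peanoBaker A t₀ x₀ n t‖ ≤ ‖x₀‖ * ((K * |t - t₀|) ^ n / n.factorial) := by
  have hK0 : 0 ≤ K := (norm_nonneg _).trans (hK t ht)
  induction n generalizing t with
  | zero => simp [peanoBaker]
  | succ n ih =>
    have hbound : ∀ s ∈ Set.uIoc t₀ t, ‖A s (peanoBaker A t₀ x₀ n s)‖ ≤
        ‖x₀‖ * K ^ (n + 1) / n.factorial * |s - t₀| ^ n := fun s hs => by
      have hsJ : s ∈ J := hJ.uIcc_subset ht₀ ht (Set.uIoc_subset_uIcc hs)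
      calc ‖A s (peanoBaker A t₀ x₀ n s)‖
          ≤ K * (‖x₀‖ * ((K * |s - t₀|) ^ n / n.factorial)) :=
            (A s).le_of_opNorm_le_of_le (hK s hsJ) (ih hsJ)
        _ = ‖x₀‖ * K ^ (n + 1) / n.factorial * |s - t₀| ^ n := by ring
    calc ‖peanoBaker A t₀ x₀ (n + 1) t‖
        ≤ |∫ s in t₀..t, ‖x₀‖ * K ^ (n + 1) / n.factorial * |s - t₀| ^ n| :=
          intervalIntegral.norm_integral_le_abs_of_norm_le
            (MeasureTheory.ae_restrict_of_forall_mem measurableSet_uIoc hbound)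
            (Continuous.intervalIntegrable (by fun_prop) _ _)
      _ = ‖x₀‖ * ((K * |t - t₀|) ^ (n + 1) / (n + 1).factorial) := by
          rw [intervalIntegral.integral_const_mul, abs_mul,
            intervalIntegral.abs_integral_eq_abs_integral_uIoc, integral_pow_abs_sub_uIoc,
            abs_of_nonneg (by positivity), abs_of_nonneg (by positivity), Nat.factorial_succ]
          push_cast
          field_simp
          ring

variable [CompleteSpace E]

theorem hasDerivAt_peanoBaker_succ (hJ : IsOpen J) (hJ' : J.OrdConnected) (hA : ContinuousOn A J)
    (ht₀ : t₀ ∈ J) (x₀ : E) (n : ℕ) {t : ℝ} (ht : t ∈ J) :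
    HasDerivAt (peanoBaker A t₀ x₀ (n + 1)) (A t (peanoBaker A t₀ x₀ n t)) t := by
  have key (n : ℕ) (hc : ContinuousOn (peanoBaker A t₀ x₀ n) J) {t : ℝ} (ht : t ∈ J) :
      HasDerivAt (peanoBaker A t₀ x₀ (n + 1)) (A t (peanoBaker A t₀ x₀ n t)) t :=
    have hint := hA.clm_apply hc
    intervalIntegral.integral_hasDerivAt_right
      (hint.mono (hJ'.uIcc_subset ht₀ ht)).intervalIntegrable
      (hint.stronglyMeasurableAtFilter hJ t ht) (hint.continuousAt (hJ.mem_nhds ht))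
  refine key n ?_ ht
  induction n with
  | zero => exact continuousOn_const
  | succ n ih => exact fun t ht => (key n ih ht).continuousAt.continuousWithinAt

theorem hasDerivAt_tsum_peanoBaker_of_norm_le (hJ : IsOpen J) (hJ' : J.OrdConnected)
    (hA : ContinuousOn A J) (ht₀ : t₀ ∈ J) {K l : ℝ} (hK : ∀ t ∈ J, ‖A t‖ ≤ K)
    (hl : ∀ t ∈ J, |t - t₀| ≤ l) (x₀ : E) {t : ℝ} (ht : t ∈ J) :
    HasDerivAt (fun s => ∑' n, peanoBaker A t₀ x₀ n s) (A t (∑' n, peanoBaker A t₀ x₀ n t)) t := by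
  have hK0 : 0 ≤ K := (norm_nonneg _).trans (hK t ht)
  have hbound : ∀ n, ∀ s ∈ J, ‖peanoBaker A t₀ x₀ n s‖ ≤ ‖x₀‖ * ((K * l) ^ n / n.factorial) :=
    fun n s hs => (norm_peanoBaker_le hJ' hK ht₀ x₀ n hs).trans (by gcongr; exact hl s hs)
  have hsum : Summable fun n : ℕ => ‖x₀‖ * ((K * l) ^ n / n.factorial) :=
    (Real.summable_pow_div_factorial _).mul_left _
  have hsumm (s : ℝ) (hs : s ∈ J) : Summable fun n => peanoBaker A t₀ x₀ n s :=
    hsum.of_norm_bounded fun n => hbound n s hs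
  have htail : HasDerivAt (fun s => ∑' n, peanoBaker A t₀ x₀ (n + 1) s)
      (∑' n, A t (peanoBaker A t₀ x₀ n t)) t :=
    hasDerivAt_tsum_of_isPreconnected (hsum.mul_left K) hJ hJ'.isPreconnected
      (fun n s hs => hasDerivAt_peanoBaker_succ hJ hJ' hA ht₀ x₀ n hs)
      (fun n s hs => (A s).le_of_opNorm_le_of_le (hK s hs) (hbound n s hs)) ht₀
      (by simpa only [peanoBaker_succ_self] using summable_zero) ht
  rw [(A t).map_tsum (hsumm t ht)]
  refine (htail.const_add x₀).congr_of_eventuallyEq ?_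
  filter_upwards [hJ.mem_nhds ht] with s hs
  exact (hsumm s hs).tsum_eq_zero_add

theorem exists_hasDerivAt_clm_apply (hJ : IsOpen J) (hJ' : J.OrdConnected) (hA : ContinuousOn A J)
    (ht₀ : t₀ ∈ J) (x₀ : E) :
    ∃ x : ℝ → E, x t₀ = x₀ ∧ ∀ t ∈ J, HasDerivAt x (A t (x t)) t := by
  refine ⟨fun t => ∑' n, peanoBaker A t₀ x₀ n t, ?_, fun t ht => ?_⟩
  · refine (tsum_eq_single 0 fun n hn => ?_).trans rfl
    obtain ⟨m, rfl⟩ := Nat.exists_eq_succ_of_ne_zero hn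
    exact peanoBaker_succ_self x₀ m
  · obtain ⟨δ, hδ, hδJ⟩ :=
      isCompact_uIcc.exists_cthickening_subset_open hJ (hJ'.uIcc_subset ht₀ ht)
    have hcpt : IsCompact (Metric.cthickening δ (Set.uIcc t₀ t)) := isCompact_uIcc.cthickening
    obtain ⟨K, hK⟩ := hcpt.exists_bound_of_continuousOn (hA.mono hδJ)
    obtain ⟨l, hl⟩ := hcpt.exists_bound_of_continuousOn (f := fun s => s - t₀) (by fun_prop)
    have hsub := Metric.thickening_subset_cthickening δ (Set.uIcc t₀ t)
    have hmem := Metric.self_subset_thickening hδ (Set.uIcc t₀ t)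
    exact hasDerivAt_tsum_peanoBaker_of_norm_le Metric.isOpen_thickening
      ((convex_uIcc t₀ t).thickening δ).ordConnected (hA.mono (hsub.trans hδJ))
      (hmem Set.left_mem_uIcc) (fun s hs => hK s (hsub hs)) (fun s hs => hl s (hsub hs)) x₀
      (hmem Set.right_mem_uIcc)

end PeanoBaker

section FundamentalSolution

variable {R : Type*} [NormedRing R] [NormedAlgebra ℝ R] {J : Set ℝ} {t₀ : ℝ} {a b : ℝ → R}
  {u x : ℝ → Rˣ}

/-- `u` is the fundamental solution on `J` of the linear differential equation `u' = a u`,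
normalized at `t₀`. Units are used as values since the argument multiplies by `u⁻¹` throughout. -/
structure IsFundamentalSolution (J : Set ℝ) (t₀ : ℝ) (a : ℝ → R) (u : ℝ → Rˣ) : Prop where
  map_init : u t₀ = 1
  hasDerivAt : ∀ t ∈ J, HasDerivAt (fun s => (u s : R)) (a t * u t) t

theorem eq_of_hasDerivAt_zero {E : Type*} [NormedAddCommGroup E] [NormedSpace ℝ E]
    (hJ : IsOpen J) (hJ' : J.OrdConnected) {f : ℝ → E} (hf : ∀ t ∈ J, HasDerivAt f 0 t)
    {s t : ℝ} (hs : s ∈ J) (ht : t ∈ J) : f s = f t :=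
  hJ.is_const_of_deriv_eq_zero hJ'.isPreconnected
    (fun r hr => (hf r hr).differentiableAt.differentiableWithinAt)
    (fun r hr => (hf r hr).deriv) hs ht

namespace IsFundamentalSolution

theorem map {S : Type*} [NormedRing S] [NormedAlgebra ℝ S] [FiniteDimensional ℝ R]
    (hu : IsFundamentalSolution J t₀ a u) (φ : R →ₐ[ℝ] S) :
    IsFundamentalSolution J t₀ (fun t => φ (a t)) fun t => Units.map φ (u t) where
  map_init := by rw [hu.map_init, map_one]
  hasDerivAt t ht := by
    have h := φ.toLinearMap.toContinuousLinearMap.hasFDerivAt.comp_hasDerivAt t (hu.hasDerivAt t ht)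
    exact h.congr_deriv (map_mul φ (a t) (u t))

section CompleteSpace

variable [CompleteSpace R]

theorem hasDerivAt_inv (hu : IsFundamentalSolution J t₀ a u) {t : ℝ} (ht : t ∈ J) :
    HasDerivAt (fun s => (↑(u s)⁻¹ : R)) (-(↑(u t)⁻¹ * a t)) t := by
  have h := (hasFDerivAt_ringInverse (𝕜 := ℝ) (u t)).comp_hasDerivAt t (hu.hasDerivAt t ht)
  simpa [Function.comp_def, mul_assoc] using h

theorem inv_mul (hu : IsFundamentalSolution J t₀ a u)
    (hx : IsFundamentalSolution J t₀ (fun t => a t + b t) x) :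
    IsFundamentalSolution J t₀ (fun t => ↑(u t)⁻¹ * b t * u t) fun t => (u t)⁻¹ * x t where
  map_init := by rw [hu.map_init, hx.map_init, inv_one, mul_one]
  hasDerivAt t ht := by
    refine ((hu.hasDerivAt_inv ht).mul (hx.hasDerivAt t ht)).congr_deriv ?_
    simp only [Units.val_mul, mul_assoc, Units.mul_inv_cancel_left]
    noncomm_ring

theorem eq_mul_of_hasDerivAt (hu : IsFundamentalSolution J t₀ a u) (hJ : IsOpen J)
    (hJ' : J.OrdConnected) (ht₀ : t₀ ∈ J) {y : ℝ → R} (hy : ∀ t ∈ J, HasDerivAt y (a t * y t) t)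
    {t : ℝ} (ht : t ∈ J) : y t = u t * y t₀ := by
  have hconst : ↑(u t)⁻¹ * y t = ↑(u t₀)⁻¹ * y t₀ :=
    eq_of_hasDerivAt_zero hJ hJ' (f := fun s => ↑(u s)⁻¹ * y s) (fun s hs =>
      ((hu.hasDerivAt_inv hs).mul (hy s hs)).congr_deriv (by noncomm_ring)) ht ht₀
  rwa [hu.map_init, inv_one, Units.val_one, one_mul, Units.inv_mul_eq_iff_eq_mul] at hconst

theorem eq_exp (hu : IsFundamentalSolution J t₀ a u) (hJ : IsOpen J) (hJ' : J.OrdConnected)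
    (ht₀ : t₀ ∈ J) {A : R} (hA : ∀ t ∈ J, a t = A) {t : ℝ} (ht : t ∈ J) :
    (u t : R) = NormedSpace.exp ((t - t₀) • A) := by
  have hexp (s : ℝ) (hs : s ∈ J) : HasDerivAt (fun s => NormedSpace.exp ((s - t₀) • A))
      (a s * NormedSpace.exp ((s - t₀) • A)) s :=
    hA s hs ▸ (hasDerivAt_exp_smul_const' A (s - t₀)).comp_sub_const s t₀
  simpa using (hu.eq_mul_of_hasDerivAt hJ hJ' ht₀ hexp ht).symm

theorem inv_mul_mul_eq (hu : IsFundamentalSolution J t₀ a u) (hJ : IsOpen J) (hJ' : J.OrdConnected)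
    (ht₀ : t₀ ∈ J) {y : ℝ → R} (hy : ∀ t ∈ J, HasDerivAt y ⁅a t, y t⁆ t) {t : ℝ} (ht : t ∈ J) :
    ↑(u t)⁻¹ * y t * u t = y t₀ := by
  have hconst : ↑(u t)⁻¹ * y t * u t = ↑(u t₀)⁻¹ * y t₀ * u t₀ :=
    eq_of_hasDerivAt_zero hJ hJ' (f := fun s => ↑(u s)⁻¹ * y s * u s) (fun s hs =>
      (((hu.hasDerivAt_inv hs).mul (hy s hs)).mul (hu.hasDerivAt s hs)).congr_deriv
        (by simp only [Ring.lie_def, Pi.mul_apply]; noncomm_ring)) ht ht₀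
  simpa [hu.map_init] using hconst

end CompleteSpace

end IsFundamentalSolution

variable [FiniteDimensional ℝ R]

theorem exists_isFundamentalSolution (hJ : IsOpen J) (hJ' : J.OrdConnected) (ht₀ : t₀ ∈ J)
    (ha : ContinuousOn a J) : ∃ u : ℝ → Rˣ, IsFundamentalSolution J t₀ a u := by
  have : CompleteSpace R := FiniteDimensional.complete ℝ R
  have : IsArtinianRing R := IsArtinianRing.of_finite ℝ R
  obtain ⟨x, hx₀, hx⟩ := exists_hasDerivAt_clm_apply hJ hJ'
    (A := fun t => ContinuousLinearMap.mul ℝ R (a t)) (by fun_prop) ht₀ 1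
  -- the inverse of `x` is constructed as the solution of the dual equation
  obtain ⟨y, hy₀, hy⟩ := exists_hasDerivAt_clm_apply hJ hJ'
    (A := fun t => -(ContinuousLinearMap.mul ℝ R).flip (a t)) (by fun_prop) ht₀ 1
  have hyx (t : ℝ) (ht : t ∈ J) : y t * x t = 1 := by
    have hconst : y t * x t = y t₀ * x t₀ :=
      eq_of_hasDerivAt_zero hJ hJ' (f := fun s => y s * x s) (fun s hs =>
        ((hy s hs).mul (hx s hs)).congr_deriv (by simp [mul_assoc])) ht ht₀
    rw [hconst, hx₀, hy₀, mul_one]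
  have hunit (t : ℝ) (ht : t ∈ J) : IsUnit (x t) := .of_mul_eq_one_right _ (hyx t ht)
  classical
  let u (t : ℝ) : Rˣ := if ht : t ∈ J then (hunit t ht).unit else 1
  have hu (t : ℝ) (ht : t ∈ J) : (u t : R) = x t := by simp [u, ht]
  refine ⟨u, Units.ext ((hu t₀ ht₀).trans hx₀), fun t ht => ?_⟩
  rw [hu t ht]
  exact (hx t ht).congr_of_eventuallyEq (Filter.eventually_of_mem (hJ.mem_nhds ht) hu)

theorem exists_isFundamentalSolution_mem (hJ : IsOpen J) (hJ' : J.OrdConnected) (ht₀ : t₀ ∈ J)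
    (S : Subalgebra ℝ R) (ha : ContinuousOn a J) (haS : ∀ t ∈ J, a t ∈ S) :
    ∃ u : ℝ → Rˣ, IsFundamentalSolution J t₀ a u ∧ ∀ t, (u t : R) ∈ S ∧ (↑(u t)⁻¹ : R) ∈ S := by
  have : FiniteDimensional ℝ S := FiniteDimensional.finiteDimensional_subalgebra S
  classical
  let b (t : ℝ) : S := if ht : t ∈ J then ⟨a t, haS t ht⟩ else 0
  have hb (t : ℝ) (ht : t ∈ J) : (b t : R) = a t := by simp [b, ht]
  have hbc : ContinuousOn b J :=
    Topology.IsInducing.subtypeVal.continuousOn_iff.2 (ha.congr hb)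
  obtain ⟨u, hu⟩ := exists_isFundamentalSolution hJ hJ' ht₀ hbc
  have hv := hu.map S.val
  refine ⟨fun t => Units.map (S.val : S →* R) (u t), ⟨hv.map_init, fun t ht => ?_⟩,
    fun t => ⟨(u t).val.2, ((u t)⁻¹).val.2⟩⟩
  rw [← hb t ht]
  exact hv.hasDerivAt t ht

end FundamentalSolution

section GradedOperators

open DirectSum (Decomposition decompose decomposeLinearEquiv decompose_lhom_ext)

/-- The finite set of the degrees of the nonzero homogeneous vectors. -/
def gradedDegrees {R M ι : Type*} [Ring R] [AddCommGroup M] [Module R M] [IsNoetherian R M]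
    [DecidableEq ι] (𝒱 : ι → Submodule R M) [Decomposition 𝒱] : Finset ι :=
  (WellFoundedGT.finite_ne_bot_of_iSupIndep
    (Decomposition.isInternal 𝒱).submodule_iSupIndep).toFinset

variable {𝕜 E ι : Type*} [NontriviallyNormedField 𝕜] [CompleteSpace 𝕜] [NormedAddCommGroup E]
  [NormedSpace 𝕜 E] [FiniteDimensional 𝕜 E] [DecidableEq ι] (𝒱 : ι → Submodule 𝕜 E)
  [Decomposition 𝒱]

/-- The projection onto the homogeneous component of degree `a`, as a continuous operator. -/
def gradedProj (a : ι) : E →L[𝕜] E :=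
  ((𝒱 a).subtype ∘ₗ DirectSum.component 𝕜 ι (fun i => 𝒱 i) a ∘ₗ
    (decomposeLinearEquiv 𝒱).toLinearMap).toContinuousLinearMap

theorem gradedProj_mem (a : ι) (v : E) : gradedProj 𝒱 a v ∈ 𝒱 a := (decompose 𝒱 v a).2

variable {𝒱}

theorem gradedProj_of_mem {a : ι} {v : E} (hv : v ∈ 𝒱 a) : gradedProj 𝒱 a v = v :=
  DirectSum.decompose_of_mem_same 𝒱 hv

theorem gradedProj_of_mem_ne {a b : ι} {v : E} (hv : v ∈ 𝒱 a) (hab : a ≠ b) :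
    gradedProj 𝒱 b v = 0 :=
  DirectSum.decompose_of_mem_ne 𝒱 hv hab

theorem gradedProj_eq_zero_of_mem_iSup {p : ι → Prop} {b : ι} (hb : ¬p b) {v : E}
    (hv : v ∈ ⨆ (a) (_ : p a), 𝒱 a) : gradedProj 𝒱 b v = 0 := by
  have hle : ⨆ (a) (_ : p a), 𝒱 a ≤ (gradedProj 𝒱 b).ker :=
    iSup₂_le fun a ha w hw => gradedProj_of_mem_ne hw fun hab => hb (hab ▸ ha)
  exact hle hv

variable (𝒱)

theorem sum_gradedProj (v : E) : ∑ a ∈ gradedDegrees 𝒱, gradedProj 𝒱 a v = v := by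
  have hsum : ∑ a ∈ gradedDegrees 𝒱, (gradedProj 𝒱 a).toLinearMap = LinearMap.id := by
    refine decompose_lhom_ext 𝒱 fun i => LinearMap.ext fun w => ?_
    simp only [LinearMap.comp_apply, LinearMap.sum_apply, Submodule.subtype_apply,
      ContinuousLinearMap.coe_coe, LinearMap.id_apply]
    rw [Finset.sum_eq_single i (fun a _ ha => gradedProj_of_mem_ne w.2 ha.symm) fun hi => ?_,
      gradedProj_of_mem w.2]
    have hbot : 𝒱 i = ⊥ := by simpa [gradedDegrees] using hi
    rw [(Submodule.eq_bot_iff _).1 hbot w w.2, map_zero]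
  simpa using LinearMap.congr_fun hsum v

variable {𝒱}

theorem mem_of_forall_gradedProj_mem {T : Submodule 𝕜 E} {v : E}
    (h : ∀ a, gradedProj 𝒱 a v ∈ T) : v ∈ T :=
  sum_gradedProj 𝒱 v ▸ T.sum_mem fun a _ => h a

theorem eq_of_forall_gradedProj_eq {v w : E} (h : ∀ a, gradedProj 𝒱 a v = gradedProj 𝒱 a w) :
    v = w := by
  rw [← sum_gradedProj 𝒱 v, ← sum_gradedProj 𝒱 w]
  exact Finset.sum_congr rfl fun a _ => h a

theorem eq_of_forall_gradedProj_apply_eq {α β : E →L[𝕜] E}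
    (h : ∀ a b, ∀ v ∈ 𝒱 a, gradedProj 𝒱 b (α v) = gradedProj 𝒱 b (β v)) : α = β :=
  ContinuousLinearMap.coe_injective <| decompose_lhom_ext 𝒱 fun a => LinearMap.ext fun v =>
    eq_of_forall_gradedProj_eq fun b => h a b v v.2

variable [AddCommGroup ι]

variable (𝒱) in
/-- The operator on endomorphisms which multiplies the homogeneous component of each degree `r` by
`ε r`. -/
def gradedMultiplier : (ι → 𝕜) →ₗ[𝕜] (E →L[𝕜] E) →ₗ[𝕜] (E →L[𝕜] E) :=
  LinearMap.mk₂ 𝕜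
    (fun ε α => ∑ a ∈ gradedDegrees 𝒱, ∑ b ∈ gradedDegrees 𝒱,
      ε (b - a) • (gradedProj 𝒱 b * α * gradedProj 𝒱 a))
    (fun ε δ α => by simp only [Pi.add_apply, add_smul, Finset.sum_add_distrib])
    (fun c ε α => by simp only [Pi.smul_apply, smul_assoc, Finset.smul_sum])
    (fun ε α β => by simp only [mul_add, add_mul, smul_add, Finset.sum_add_distrib])
    (fun c ε α => by
      simp only [mul_smul_comm, smul_mul_assoc, smul_comm c, Finset.smul_sum])

variable (ε : ι → 𝕜) (α : E →L[𝕜] E)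

theorem gradedProj_gradedMultiplier {a : ι} {v : E} (hv : v ∈ 𝒱 a) (b : ι) :
    gradedProj 𝒱 b (gradedMultiplier 𝒱 ε α v) = ε (b - a) • gradedProj 𝒱 b (α v) := by
  set S := gradedDegrees 𝒱
  have hsource (a' b' : ι) : ε (b' - a') • gradedProj 𝒱 b' (α (gradedProj 𝒱 a' v)) =
      ε (b' - a) • gradedProj 𝒱 b' (α (gradedProj 𝒱 a' v)) := by
    obtain rfl | ha := eq_or_ne a a'
    · rfl
    · simp only [gradedProj_of_mem_ne hv ha, map_zero, smul_zero]
  have htarget (b' : ι) : gradedProj 𝒱 b (ε (b' - a) • gradedProj 𝒱 b' (α v)) =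
      ε (b - a) • gradedProj 𝒱 b (gradedProj 𝒱 b' (α v)) := by
    rw [map_smul]
    obtain rfl | hb := eq_or_ne b' b
    · rfl
    · rw [gradedProj_of_mem_ne (gradedProj_mem 𝒱 b' _) hb, smul_zero, smul_zero]
  calc gradedProj 𝒱 b (gradedMultiplier 𝒱 ε α v)
      = gradedProj 𝒱 b (∑ a' ∈ S, ∑ b' ∈ S,
          ε (b' - a') • gradedProj 𝒱 b' (α (gradedProj 𝒱 a' v))) := by
        simp [gradedMultiplier, S]
    _ = gradedProj 𝒱 b (∑ b' ∈ S, ε (b' - a) • gradedProj 𝒱 b' (α v)) := by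
        simp only [hsource]
        rw [Finset.sum_comm]
        simp only [← Finset.smul_sum, ← map_sum, S, sum_gradedProj]
    _ = ε (b - a) • gradedProj 𝒱 b (α v) := by
        rw [map_sum]
        simp only [htarget, ← Finset.smul_sum, ← map_sum, S, sum_gradedProj]

theorem gradedMultiplier_mem {T : Submodule 𝕜 E} {a : ι} {v : E} (hv : v ∈ 𝒱 a)
    (h : ∀ b, ε (b - a) ≠ 0 → gradedProj 𝒱 b (α v) ∈ T) : gradedMultiplier 𝒱 ε α v ∈ T := by
  refine mem_of_forall_gradedProj_mem (𝒱 := 𝒱) fun b => ?_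
  rw [gradedProj_gradedMultiplier ε α hv]
  by_cases hε : ε (b - a) = 0
  · rw [hε, zero_smul]
    exact T.zero_mem
  · exact T.smul_mem _ (h b hε)

theorem gradedMultiplier_one : gradedMultiplier 𝒱 1 α = α :=
  eq_of_forall_gradedProj_apply_eq (𝒱 := 𝒱) fun a b v hv => by
    rw [gradedProj_gradedMultiplier 1 α hv, Pi.one_apply, one_smul]

variable {α} in
theorem gradedMultiplier_of_homogeneous {r : ι} (h : ∀ a, ∀ v ∈ 𝒱 a, α v ∈ 𝒱 (a + r)) :
    gradedMultiplier 𝒱 ε α = ε r • α := by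
  refine eq_of_forall_gradedProj_apply_eq (𝒱 := 𝒱) fun a b v hv => ?_
  rw [gradedProj_gradedMultiplier ε α hv, smul_apply, map_smul]
  obtain rfl | hb := eq_or_ne (a + r) b
  · rw [add_sub_cancel_left]
  · rw [gradedProj_of_mem_ne (h a v hv) hb, smul_zero, smul_zero]

theorem gradedMultiplier_single_mem (r : ι) {a : ι} {v : E} (hv : v ∈ 𝒱 a) :
    gradedMultiplier 𝒱 (Pi.single r 1) α v ∈ 𝒱 (a + r) := by
  refine gradedMultiplier_mem _ α hv fun b hb => ?_
  obtain rfl : b - a = r := by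
    by_contra hne
    exact hb (Pi.single_eq_of_ne hne 1)
  rw [add_sub_cancel]
  exact gradedProj_mem 𝒱 b _

theorem gradedMultiplier_mem_of_single_mem {T : Submodule 𝕜 (E →L[𝕜] E)}
    (h : ∀ r, ε r ≠ 0 → gradedMultiplier 𝒱 (Pi.single r 1) α ∈ T) :
    gradedMultiplier 𝒱 ε α ∈ T := by
  set R := Finset.image₂ (fun a b => b - a) (gradedDegrees 𝒱) (gradedDegrees 𝒱)
  have hε : ∀ r ∈ R, (∑ s ∈ R, ε s • Pi.single s (1 : 𝕜) : ι → 𝕜) r = ε r := fun r hr => by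
    simp [Finset.sum_apply, Pi.single_apply, hr]
  have hsum : gradedMultiplier 𝒱 ε α = gradedMultiplier 𝒱 (∑ s ∈ R, ε s • Pi.single s 1) α :=
    Finset.sum_congr rfl fun a ha => Finset.sum_congr rfl fun b hb => by
      rw [hε _ (Finset.mem_image₂_of_mem ha hb)]
  rw [hsum, map_sum, LinearMap.sum_apply]
  refine T.sum_mem fun r _ => ?_
  rw [map_smul, LinearMap.smul_apply]
  by_cases hr : ε r = 0
  · rw [hr, zero_smul]
    exact T.zero_mem
  · exact T.smul_mem _ (h r hr)

end GradedOperators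

theorem iSupIndep_of_disjoint_iSup_lt {R M ι κ : Type*} [Ring R] [AddCommGroup M] [Module R M]
    [LinearOrder κ] {𝒱 : ι → Submodule R M} {w : ι → κ} (hw : Function.Injective w)
    (h : ∀ a, Disjoint (𝒱 a) (⨆ (b) (_ : w b < w a), 𝒱 b)) : iSupIndep 𝒱 := by
  classical
  rw [iSupIndep_iff_finsetSum_eq_zero_imp_eq_zero]
  intro s
  induction s using Finset.induction_on_max_value w with
  | empty => simp
  | @insert a s has hmax ih =>
    intro v hv hsum
    rw [Finset.sum_insert has] at hsum
    have hrest : ∑ b ∈ s, v b ∈ ⨆ (b) (_ : w b < w a), 𝒱 b :=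
      Submodule.sum_mem _ fun b hb =>
        have hlt : w b < w a := (hmax b hb).lt_of_ne fun he => has (hw he ▸ hb)
        Submodule.mem_iSup_of_mem b (Submodule.mem_iSup_of_mem hlt (hv b (by simp [hb])))
    have ha : v a = 0 := Submodule.disjoint_def.1 (h a) _ (hv a (by simp))
      (eq_neg_of_add_eq_zero_left hsum ▸ neg_mem hrest)
    rw [ha, zero_add] at hsum
    exact Finset.forall_mem_insert _ _ _ |>.2 ⟨ha, ih v (fun b hb => hv b (by simp [hb])) hsum⟩

namespace MixedHodge.Data

section DeligneBigrading

variable {V : Type*} [NormedAddCommGroup V] [NormedSpace ℂ V] {D : Data V} {F : Fil V}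

theorem cls_eq_zero_iff {k : ℤ} (u : D.W k) : D.cls u = 0 ↔ (u : V) ∈ D.W (k - 1) :=
  Submodule.Quotient.mk_eq_zero _

theorem cls_eq_cls_iff {k : ℤ} (u v : D.W k) : D.cls u = D.cls v ↔ (u : V) - v ∈ D.W (k - 1) :=
  Submodule.Quotient.eq _

theorem exists_W_sub_eq_bot (D : Data V) (k : ℤ) : ∃ n : ℕ, D.W (k - n) = ⊥ := by
  obtain ⟨k₀, h⟩ := D.W_bot
  exact ⟨(k - k₀).toNat, le_bot_iff.1 ((D.W_mono (by lia)).trans h.le)⟩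

namespace IsMHS

theorem antitone_conjFil (hF : D.IsMHS F) : Antitone (D.conjFil F) :=
  fun _ _ h => Submodule.map_mono (hF.antitone h)

theorem W_le_sup (hF : D.IsMHS F) {p q k : ℤ} (hpq : p + q = k + 1) :
    D.W k ≤ F p ⊓ D.W k ⊔ D.conjFil F q ⊓ D.W k ⊔ D.W (k - 1) := by
  intro w hw
  obtain rfl : q = k + 1 - p := by lia
  have htop := (hF.isCompl k p).sup_eq_top.ge (Submodule.mem_top (x := D.cls ⟨w, hw⟩))
  obtain ⟨_, ⟨f, hf, rfl⟩, _, ⟨g, hg, rfl⟩, hfg⟩ := Submodule.mem_sup.1 htop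
  have hrest : w - (f + g) ∈ D.W (k - 1) := (cls_eq_cls_iff ⟨w, hw⟩ (f + g)).1 hfg.symm
  rw [← add_sub_cancel (f + g : V) w]
  exact Submodule.add_mem_sup (Submodule.add_mem_sup ⟨hf, f.2⟩ ⟨hg, g.2⟩) hrest

theorem inf_conjFil_sup_le (hF : D.IsMHS F) {p q k : ℤ} (hpq : k + 1 ≤ p + q) :
    F p ⊓ D.W k ⊓ (D.conjFil F q ⊓ D.W k ⊔ D.W (k - 1)) ≤ D.W (k - 1) := by
  rintro f ⟨⟨hf, hfW⟩, hfg⟩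
  obtain ⟨g, ⟨hg, hgW⟩, w, hw, rfl⟩ := Submodule.mem_sup.1 hfg
  have hg' : g ∈ D.conjFil F (k + 1 - p) := hF.antitone_conjFil (by lia) hg
  have hcls : D.cls ⟨g, hgW⟩ = D.cls ⟨g + w, hfW⟩ := by
    rw [cls_eq_cls_iff]
    simpa using hw
  exact (cls_eq_zero_iff _).1 <| Submodule.disjoint_def.1 (hF.isCompl k p).disjoint _
    ⟨⟨g + w, hfW⟩, hf, rfl⟩ ⟨⟨g, hgW⟩, hg', hcls⟩

theorem inf_conjFil_inf_W_eq_bot (hF : D.IsMHS F) {p q k : ℤ} (hpq : k + 1 ≤ p + q) :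
    F p ⊓ D.conjFil F q ⊓ D.W k = ⊥ := by
  have hdescend (n : ℕ) : F p ⊓ D.conjFil F q ⊓ D.W k ≤ D.W (k - n) := by
    induction n with
    | zero => simp
    | succ n ih =>
      intro x hx
      rw [Nat.cast_succ, ← sub_sub]
      exact hF.inf_conjFil_sup_le (p := p) (q := q) (by lia)
        ⟨⟨hx.1.1, ih hx⟩, Submodule.mem_sup_left ⟨hx.1.2, ih hx⟩⟩
  obtain ⟨n, hn⟩ := D.exists_W_sub_eq_bot k
  exact le_bot_iff.1 (hn ▸ hdescend n)

end IsMHS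

/-- The factor in the definition of `I^{p,q}` which involves the conjugate filtration. -/
def conjFactor (D : Data V) (F : Fil V) (p q : ℤ) : Submodule ℂ V :=
  D.conjFil F q ⊓ D.W (p + q) ⊔
    ⨆ (j : ℤ) (_ : 0 < j), D.conjFil F (q - j) ⊓ D.W (p + q - 1 - j)

theorem conjFil_inf_W_le_conjFactor (n : ℕ) (p q : ℤ) :
    D.conjFil F (q - n) ⊓ D.W (p + q - 1 - n) ≤ D.conjFactor F p q := by
  rcases n.eq_zero_or_pos with rfl | hn
  · rw [Nat.cast_zero, sub_zero, sub_zero]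
    exact le_sup_of_le_left (inf_le_inf_left _ (D.W_mono (by lia)))
  · exact le_sup_of_le_right (le_iSup₂_of_le (n : ℤ) (by lia) le_rfl)

namespace IsMHS

theorem inf_conjFactor_sup_le (hF : D.IsMHS F) (p q : ℤ) :
    F p ⊓ D.W (p + q) ⊓ (D.conjFactor F p q ⊔ D.W (p + q - 1)) ≤
      D.I F p q ⊔ F p ⊓ D.W (p + q - 1) := by
  set S := D.conjFactor F p q
  set T : ℕ → Submodule ℂ V := fun n => F p ⊓ D.W (p + q) ⊓ (S ⊔ D.W (p + q - 1 - n))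
  -- Splitting the error in `W (k - 1 - n)` by the Hodge structure of weight `k - 1 - n`, its
  -- conjugate part is absorbed by the `n`-th summand of `conjFactor`.
  have hstep (n : ℕ) : T n ≤ T (n + 1) ⊔ F p ⊓ D.W (p + q - 1) := by
    rintro x ⟨hx, hxS⟩
    obtain ⟨s, hs, w, hw, rfl⟩ := Submodule.mem_sup.1 hxS
    obtain ⟨y, hy, w', hw', rfl⟩ := Submodule.mem_sup.1 <|
      hF.W_le_sup (p := p) (q := q - n) (by lia) hw
    obtain ⟨f, hf, g, hg, rfl⟩ := Submodule.mem_sup.1 hy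
    have hfW : f ∈ D.W (p + q - 1) := D.W_mono (by lia) hf.2
    have hsplit : s + (f + g + w') - f = s + g + w' := by abel
    have hrest : s + g + w' ∈ T (n + 1) := by
      refine ⟨hsplit ▸ sub_mem hx ⟨hf.1, D.W_mono (by lia) hfW⟩,
        Submodule.add_mem_sup (add_mem hs (conjFil_inf_W_le_conjFactor n p q hg)) ?_⟩
      rwa [Nat.cast_succ, ← sub_sub]
    rw [← sub_add_cancel (s + (f + g + w')) f, hsplit]
    exact Submodule.add_mem_sup hrest ⟨hf.1, hfW⟩
  have hdescend (n : ℕ) : T 0 ≤ T n ⊔ F p ⊓ D.W (p + q - 1) := by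
    induction n with
    | zero => exact le_sup_left
    | succ n ih => exact ih.trans (sup_le (hstep n) le_sup_right)
  obtain ⟨n, hn⟩ := D.exists_W_sub_eq_bot (p + q - 1)
  simpa [T, hn, S, conjFactor, I] using hdescend n

theorem F_inf_W_le_sup (hF : D.IsMHS F) (p q : ℤ) :
    F p ⊓ D.W (p + q) ≤
      F (p + 1) ⊓ D.W (p + q) ⊔ (D.I F p q ⊔ F p ⊓ D.W (p + q - 1)) := by
  intro v hv
  obtain ⟨y, hy, w, hw, rfl⟩ := Submodule.mem_sup.1 <|
    hF.W_le_sup (p := p + 1) (q := q) (by lia) hv.2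
  obtain ⟨f, hf, g, hg, rfl⟩ := Submodule.mem_sup.1 hy
  have hgw : g + w ∈ F p ⊓ D.W (p + q) := by
    have hf' : f ∈ F p ⊓ D.W (p + q) := ⟨hF.antitone (by lia) hf.1, hf.2⟩
    simpa [add_assoc] using sub_mem hv hf'
  rw [add_assoc]
  exact Submodule.add_mem_sup hf <| hF.inf_conjFactor_sup_le p q
    ⟨hgw, Submodule.add_mem_sup (Submodule.mem_sup_left hg) hw⟩

theorem F_inf_W_le_iSup_I (hF : D.IsMHS F) (p k : ℤ) :
    F p ⊓ D.W k ≤ ⨆ (a : ℤ × ℤ) (_ : p ≤ a.1 ∧ a.1 + a.2 ≤ k), D.I F a.1 a.2 := by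
  obtain ⟨p₁, hp₁⟩ := hF.separated
  obtain ⟨k₀, hk₀⟩ := D.W_bot
  induction hm : (k - k₀).toNat + (p₁ - p).toNat using Nat.strong_induction_on
    generalizing p k with | _ m ih
  obtain hk | hk := le_or_gt k k₀
  · exact inf_le_right.trans ((D.W_mono hk).trans (hk₀.le.trans bot_le))
  obtain hp | hp := le_or_gt p₁ p
  · exact inf_le_left.trans ((hF.antitone hp).trans (hp₁.le.trans bot_le))
  have hF_step := hF.F_inf_W_le_sup p (k - p)
  rw [add_sub_cancel] at hF_step
  refine hF_step.trans (sup_le ?_ (sup_le ?_ ?_))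
  · exact (ih _ (by lia) (p + 1) k rfl).trans <|
      biSup_mono fun a ha => ⟨by lia, ha.2⟩
  · exact le_iSup₂_of_le (p, k - p) ⟨le_rfl, by simp⟩ le_rfl
  · exact (ih _ (by lia) p (k - 1) rfl).trans <|
      biSup_mono fun a ha => ⟨ha.1, by lia⟩

theorem W_le_iSup_I (hF : D.IsMHS F) (k : ℤ) :
    D.W k ≤ ⨆ (a : ℤ × ℤ) (_ : a.1 + a.2 ≤ k), D.I F a.1 a.2 := by
  obtain ⟨p, hp⟩ := hF.exhaustive
  exact (le_inf (hp ▸ le_top) le_rfl).trans <| (hF.F_inf_W_le_iSup_I p k).trans <|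
    biSup_mono fun a ha => ha.2

theorem F_le_iSup_I (hF : D.IsMHS F) (p : ℤ) :
    F p ≤ ⨆ (a : ℤ × ℤ) (_ : p ≤ a.1), D.I F a.1 a.2 := by
  obtain ⟨k, hk⟩ := D.W_top
  exact (le_inf le_rfl (hk ▸ le_top)).trans <| (hF.F_inf_W_le_iSup_I p k).trans <|
    biSup_mono fun a ha => ha.1

end IsMHS

/-- The Deligne bigrading of `(F, W)`, indexed by pairs. -/
abbrev bigrading (D : Data V) (F : Fil V) (a : ℤ × ℤ) : Submodule ℂ V := D.I F a.1 a.2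

/-- `(F, W)` is a mixed Hodge structure which is split over the reals. -/
structure IsSplit (D : Data V) (F : Fil V) : Prop extends D.IsMHS F where
  map_conj_I : ∀ p q, (D.I F p q).map D.conj = D.I F q p

theorem I_le_F (p q : ℤ) : D.I F p q ≤ F p := inf_le_left.trans inf_le_left

theorem I_le_W (p q : ℤ) : D.I F p q ≤ D.W (p + q) := inf_le_left.trans inf_le_right

namespace IsSplit

theorem conj_mem_bigrading (hF : D.IsSplit F) {a : ℤ × ℤ} {v : V} (hv : v ∈ D.bigrading F a) :
    D.conj v ∈ D.bigrading F a.swap :=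
  (hF.map_conj_I a.1 a.2).le (Submodule.mem_map_of_mem hv)

theorem I_le_conjFil (hF : D.IsSplit F) (p q : ℤ) : D.I F p q ≤ D.conjFil F q :=
  hF.map_conj_I q p ▸ Submodule.map_mono (I_le_F q p)

theorem disjoint_bigrading (hF : D.IsSplit F) (p q : ℤ) :
    Disjoint (D.I F p q) (F (p + 1) ⊓ D.W (p + q) ⊔ D.W (p + q - 1)) := by
  rw [Submodule.disjoint_def]
  intro x hx hx'
  have hconj := hF.I_le_conjFil p q hx
  have hxW : x ∈ D.W (p + q - 1) := by
    obtain ⟨f, hf, w, hw, rfl⟩ := Submodule.mem_sup.1 hx'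
    have hfconj : f ∈ D.conjFil F q ⊓ D.W (p + q) ⊔ D.W (p + q - 1) :=
      add_sub_cancel_right f w ▸ Submodule.sub_mem_sup ⟨hconj, I_le_W p q hx⟩ hw
    exact add_mem (hF.inf_conjFil_sup_le (by lia) ⟨hf, hfconj⟩) hw
  simpa using (hF.inf_conjFil_inf_W_eq_bot (k := p + q - 1) (by lia)).le
    ⟨⟨I_le_F p q hx, hconj⟩, hxW⟩

theorem isInternal (hF : D.IsSplit F) : DirectSum.IsInternal (D.bigrading F) := by
  refine DirectSum.isInternal_submodule_of_iSupIndep_of_iSup_eq_top ?_ ?_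
  · refine iSupIndep_of_disjoint_iSup_lt (w := fun a => toLex (a.1 + a.2, -a.1)) ?_ fun a => ?_
    · rintro ⟨p, q⟩ ⟨p', q'⟩ h
      simp only [EmbeddingLike.apply_eq_iff_eq, Prod.mk.injEq] at h ⊢
      lia
    · refine (hF.disjoint_bigrading a.1 a.2).mono_right (iSup₂_le fun b hb => ?_)
      obtain hlt | ⟨heq, hlt⟩ := Prod.Lex.toLex_lt_toLex.1 hb
      · exact le_sup_of_le_right ((I_le_W b.1 b.2).trans (D.W_mono (by lia)))
      · exact le_sup_of_le_left <| le_inf ((I_le_F b.1 b.2).trans (hF.antitone (by lia)))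
          ((I_le_W b.1 b.2).trans (D.W_mono (by lia)))
  · obtain ⟨p, hp⟩ := hF.exhaustive
    rw [eq_top_iff, ← hp]
    exact (hF.F_le_iSup_I p).trans (iSup_mono fun a => iSup_const_le)

end IsSplit

end DeligneBigrading

section GradedProjections

open DirectSum (Decomposition)

variable {V : Type*} [NormedAddCommGroup V] [NormedSpace ℂ V] [FiniteDimensional ℂ V]
  {D : Data V} {F : Fil V} [Decomposition (D.bigrading F)]

theorem IsMHS.gradedProj_eq_zero_of_mem_W (hF : D.IsMHS F) {k : ℤ} {v : V} (hv : v ∈ D.W k)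
    {a : ℤ × ℤ} (ha : k < a.1 + a.2) : gradedProj (D.bigrading F) a v = 0 :=
  gradedProj_eq_zero_of_mem_iSup (𝒱 := D.bigrading F) (p := fun a => a.1 + a.2 ≤ k)
    (not_le.2 ha) (hF.W_le_iSup_I k hv)

theorem gradedProj_mem_W {a : ℤ × ℤ} {k : ℤ} (ha : a.1 + a.2 ≤ k) (v : V) :
    gradedProj (D.bigrading F) a v ∈ D.W k :=
  D.W_mono ha (I_le_W _ _ (gradedProj_mem (D.bigrading F) a v))

theorem IsSplit.conj_gradedProj (hF : D.IsSplit F) (a : ℤ × ℤ) (v : V) :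
    D.conj (gradedProj (D.bigrading F) a v) =
      gradedProj (D.bigrading F) a.swap (D.conj v) := by
  induction v using Decomposition.inductionOn (D.bigrading F) with
  | zero => simp only [map_zero]
  | @homogeneous b v =>
    have hconj := hF.conj_mem_bigrading v.2
    obtain rfl | hab := eq_or_ne b a
    · rw [gradedProj_of_mem v.2, gradedProj_of_mem hconj]
    · rw [gradedProj_of_mem_ne v.2 hab, gradedProj_of_mem_ne hconj (Prod.swap_injective.ne hab),
        map_zero]
  | add v w hv hw => simp only [map_add, hv, hw]

theorem IsMHS.gradedMultiplier_mem_W (hF : D.IsMHS F) (ε : ℤ × ℤ → ℂ) {α : V →L[ℂ] V}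
    (hα : ∀ k, ∀ v ∈ D.W k, α v ∈ D.W k) (k : ℤ) {v : V} (hv : v ∈ D.W k) :
    gradedMultiplier (D.bigrading F) ε α v ∈ D.W k := by
  suffices hle : D.W k ≤ (D.W k).comap (gradedMultiplier (D.bigrading F) ε α).toLinearMap from
    hle hv
  refine (hF.W_le_iSup_I k).trans (iSup₂_le fun a ha w hw => ?_)
  refine gradedMultiplier_mem (𝒱 := D.bigrading F) ε α hw fun b _ => ?_
  obtain hb | hb := le_or_gt (b.1 + b.2) k
  · exact gradedProj_mem_W hb _
  · rw [hF.gradedProj_eq_zero_of_mem_W (hα k w (D.W_mono ha (I_le_W _ _ hw))) hb]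
    exact zero_mem _

theorem IsMHS.gradedMultiplier_mem_F (hF : D.IsMHS F) {ε : ℤ × ℤ → ℂ}
    (hε : ∀ r, ε r ≠ 0 → 0 ≤ r.1) (α : V →L[ℂ] V) {p : ℤ} {v : V} (hv : v ∈ F p) :
    gradedMultiplier (D.bigrading F) ε α v ∈ F p := by
  suffices hle : F p ≤ (F p).comap (gradedMultiplier (D.bigrading F) ε α).toLinearMap from hle hv
  refine (hF.F_le_iSup_I p).trans (iSup₂_le fun a ha w hw => ?_)
  refine gradedMultiplier_mem (𝒱 := D.bigrading F) ε α hw fun b hb => ?_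
  have hab : 0 ≤ b.1 - a.1 := hε _ hb
  exact hF.antitone (by lia : p ≤ b.1) (I_le_F _ _ (gradedProj_mem (D.bigrading F) b (α w)))

/-- Modulo `W (k - 2)` only the degrees with a nonnegative entry matter, and there the conjugation
exchanges the multipliers of `r` and `r.swap`. -/
theorem IsSplit.gradedMultiplier_conj_sub_mem (hF : D.IsSplit F) {ε : ℤ × ℤ → ℂ}
    (hε : ∀ r, 0 ≤ r.1 ∨ 0 ≤ r.2 → starRingEnd ℂ (ε r.swap) = ε r) {α : V →L[ℂ] V}
    (hα : ∀ k, ∀ v ∈ D.W k, D.conj (α v) - α (D.conj v) ∈ D.W (k - 2)) (k : ℤ) {v : V}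
    (hv : v ∈ D.W k) :
    D.conj (gradedMultiplier (D.bigrading F) ε α v) -
      gradedMultiplier (D.bigrading F) ε α (D.conj v) ∈ D.W (k - 2) := by
  set f := gradedMultiplier (D.bigrading F) ε α
  suffices hle : D.W k ≤ (D.W (k - 2)).comap
      (D.conj.comp f.toLinearMap - f.toLinearMap.comp D.conj) from hle hv
  refine (hF.W_le_iSup_I k).trans (iSup₂_le fun a ha w hw => ?_)
  change D.conj (f w) - f (D.conj w) ∈ D.W (k - 2)
  refine mem_of_forall_gradedProj_mem (𝒱 := D.bigrading F) fun c => ?_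
  obtain hc | hc := le_or_gt (c.1 + c.2) (k - 2)
  · exact gradedProj_mem_W hc _
  have hreal : gradedProj (D.bigrading F) c (D.conj (α w)) =
      gradedProj (D.bigrading F) c (α (D.conj w)) := by
    rw [← sub_eq_zero, ← map_sub]
    exact hF.gradedProj_eq_zero_of_mem_W (hα k w (D.W_mono ha (I_le_W _ _ hw))) hc
  have hdeg : (c.swap - a).swap = c - a.swap := rfl
  have hε' : starRingEnd ℂ (ε (c.swap - a)) = ε (c - a.swap) := by
    rw [← hdeg]
    exact hε (c.swap - a).swap (by simp only [Prod.swap, Prod.fst_sub, Prod.snd_sub]; lia)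
  have hconj : gradedProj (D.bigrading F) c (D.conj (f w)) =
      gradedProj (D.bigrading F) c (f (D.conj w)) :=
    calc gradedProj (D.bigrading F) c (D.conj (f w))
        = D.conj (gradedProj (D.bigrading F) c.swap (f w)) := by
          rw [hF.conj_gradedProj, Prod.swap_swap]
      _ = ε (c - a.swap) • gradedProj (D.bigrading F) c (D.conj (α w)) := by
          rw [gradedProj_gradedMultiplier ε α hw, LinearMap.map_smulₛₗ, hε', hF.conj_gradedProj,
            Prod.swap_swap]
      _ = gradedProj (D.bigrading F) c (f (D.conj w)) := by
          rw [gradedProj_gradedMultiplier ε α (hF.conj_mem_bigrading hw), hreal]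
  rw [map_sub, hconj, sub_self]
  exact zero_mem _

end GradedProjections

section Form

variable {V : Type*} [NormedAddCommGroup V] [NormedSpace ℂ V] [FiniteDimensional ℂ V]

/-- A bilinear form on `V` which induces `Q k` on `W k`; its values outside of `W k` are
irrelevant. -/
def form (D : Data V) (k : ℤ) : V →L[ℂ] V →L[ℂ] ℂ := (D.exists_form k).choose

variable {D : Data V} {F : Fil V} {k : ℤ} {u v : V}

theorem form_eq_Q (u v : D.W k) : D.form k u v = D.Q k (D.cls u) (D.cls v) :=
  (D.exists_form k).choose_spec u v

theorem form_symm (hu : u ∈ D.W k) (hv : v ∈ D.W k) :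
    D.form k u v = (-1) ^ k * D.form k v u :=
  (form_eq_Q ⟨u, hu⟩ ⟨v, hv⟩).trans <|
    (D.Q_parity k _ _).trans (congrArg _ (form_eq_Q ⟨v, hv⟩ ⟨u, hu⟩).symm)

theorem form_conj (hu : u ∈ D.W k) (hv : v ∈ D.W k) :
    D.form k (D.conj u) (D.conj v) = starRingEnd ℂ (D.form k u v) := by
  rw [form_eq_Q ⟨u, hu⟩ ⟨v, hv⟩, form_eq_Q ⟨D.conj u, D.W_real k u hu⟩ ⟨D.conj v, D.W_real k v hv⟩]
  exact D.Q_real k _ _ _ _ rfl rfl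

theorem form_eq_zero_of_mem_right (hu : u ∈ D.W k) (hv : v ∈ D.W (k - 1)) :
    D.form k u v = 0 := by
  have hvW : v ∈ D.W k := D.W_mono (by lia) hv
  rw [form_eq_Q ⟨u, hu⟩ ⟨v, hvW⟩, (cls_eq_zero_iff ⟨v, hvW⟩).2 hv, map_zero]

theorem form_eq_zero_of_mem_left (hu : u ∈ D.W (k - 1)) (hv : v ∈ D.W k) :
    D.form k u v = 0 := by
  rw [form_symm (D.W_mono (by lia) hu) hv, form_eq_zero_of_mem_right hv hu, mul_zero]

theorem mem_lieGC_iff {α : V →L[ℂ] V} :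
    α ∈ D.lieGC ↔ (∀ k, ∀ v ∈ D.W k, α v ∈ D.W k) ∧
      ∀ k, ∀ u ∈ D.W k, ∀ v ∈ D.W k, D.form k (α u) v + D.form k u (α v) = 0 := by
  refine and_congr_right fun hW => ⟨fun h k u hu v hv => ?_, fun h k u v u' v' hu' hv' => ?_⟩
  · rw [form_eq_Q ⟨_, hW k u hu⟩ ⟨v, hv⟩, form_eq_Q ⟨u, hu⟩ ⟨_, hW k v hv⟩]
    exact h k ⟨u, hu⟩ ⟨v, hv⟩ _ _ rfl rfl
  · rw [← form_eq_Q, ← form_eq_Q, hu', hv']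
    exact h k u u.2 v v.2

/-- The first Hodge-Riemann bilinear relation for `F` on all the graded quotients. -/
def IsIsotropic (D : Data V) (F : Fil V) : Prop :=
  ∀ k p, ∀ x ∈ D.grSub k (F p), ∀ y ∈ D.grSub k (F (k + 1 - p)), D.Q k x y = 0

theorem IsIsotropic.form_eq_zero (hQ : D.IsIsotropic F) (hF : Antitone F) {p q : ℤ}
    (hpq : k + 1 ≤ p + q) (hu : u ∈ F p ⊓ D.W k) (hv : v ∈ F q ⊓ D.W k) : D.form k u v = 0 := by
  rw [form_eq_Q ⟨u, hu.2⟩ ⟨v, hv.2⟩]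
  exact hQ k p _ ⟨⟨u, hu.2⟩, hu.1, rfl⟩ _
    ⟨⟨v, hv.2⟩, hF (by lia : k + 1 - p ≤ q) hv.1, rfl⟩

theorem IsIsotropic.form_eq_zero_of_mem_bigrading (hQ : D.IsIsotropic F) (hF : D.IsSplit F)
    {a b : ℤ × ℤ} (ha : a.1 + a.2 = k) (hb : b.1 + b.2 = k) (hab : b ≠ a.swap)
    (hu : u ∈ D.bigrading F a) (hv : v ∈ D.bigrading F b) : D.form k u v = 0 := by
  have huW : u ∈ D.W k := ha ▸ I_le_W _ _ hu
  have hvW : v ∈ D.W k := hb ▸ I_le_W _ _ hv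
  have hne : a.1 + b.1 ≠ k := fun h =>
    hab (by ext <;> simp only [Prod.fst_swap, Prod.snd_swap] <;> lia)
  obtain hlt | hgt := hne.lt_or_gt
  · have hconj : D.form k (D.conj u) (D.conj v) = 0 :=
      hQ.form_eq_zero hF.antitone (p := a.2) (q := b.2) (by lia)
        ⟨I_le_F _ _ (hF.conj_mem_bigrading hu), D.W_real k u huW⟩
        ⟨I_le_F _ _ (hF.conj_mem_bigrading hv), D.W_real k v hvW⟩
    rwa [form_conj huW hvW, map_eq_zero] at hconj
  · exact hQ.form_eq_zero hF.antitone hgt ⟨I_le_F _ _ hu, huW⟩ ⟨I_le_F _ _ hv, hvW⟩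

variable [DirectSum.Decomposition (D.bigrading F)]

theorem IsIsotropic.form_gradedProj_swap (hQ : D.IsIsotropic F) (hF : D.IsSplit F) {a : ℤ × ℤ}
    (ha : a.1 + a.2 = k) (hu : u ∈ D.bigrading F a) (hv : v ∈ D.W k) :
    D.form k u (gradedProj (D.bigrading F) a.swap v) = D.form k u v := by
  have huW : u ∈ D.W k := ha ▸ I_le_W _ _ hu
  suffices hker : v - gradedProj (D.bigrading F) a.swap v ∈ (D.form k u).ker by
    rw [eq_comm, ← sub_eq_zero, ← map_sub]
    exact hker
  refine mem_of_forall_gradedProj_mem (𝒱 := D.bigrading F) fun b => ?_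
  obtain rfl | hab := eq_or_ne b a.swap
  · rw [map_sub, gradedProj_of_mem (gradedProj_mem _ _ _), sub_self]
    exact zero_mem _
  rw [map_sub, gradedProj_of_mem_ne (gradedProj_mem _ _ _) hab.symm, sub_zero]
  obtain hb | hb | hb := lt_trichotomy (b.1 + b.2) k
  · exact form_eq_zero_of_mem_right huW (gradedProj_mem_W (by lia) v)
  · exact hQ.form_eq_zero_of_mem_bigrading hF ha hb hab hu (gradedProj_mem _ _ _)
  · rw [hF.gradedProj_eq_zero_of_mem_W hv hb]
    exact zero_mem _

theorem IsIsotropic.form_gradedMultiplier (hQ : D.IsIsotropic F) (hF : D.IsSplit F)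
    (ε : ℤ × ℤ → ℂ) {α : V →L[ℂ] V} (hα : ∀ k, ∀ v ∈ D.W k, α v ∈ D.W k) {a b : ℤ × ℤ}
    (ha : a.1 + a.2 = k) (hb : b.1 + b.2 = k) (hu : u ∈ D.bigrading F a)
    (hv : v ∈ D.bigrading F b) :
    D.form k u (gradedMultiplier (D.bigrading F) ε α v) =
      ε (a.swap - b) * D.form k u (α v) := by
  have hvW : v ∈ D.W k := hb ▸ I_le_W _ _ hv
  rw [← hQ.form_gradedProj_swap hF ha hu (hF.gradedMultiplier_mem_W ε hα k hvW),
    gradedProj_gradedMultiplier ε α hv, map_smul, smul_eq_mul,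
    hQ.form_gradedProj_swap hF ha hu (hα k v hvW)]

theorem IsIsotropic.gradedMultiplier_mem_lieGC (hQ : D.IsIsotropic F) (hF : D.IsSplit F)
    (ε : ℤ × ℤ → ℂ) {α : V →L[ℂ] V} (hα : α ∈ D.lieGC) :
    gradedMultiplier (D.bigrading F) ε α ∈ D.lieGC := by
  obtain ⟨hαW, hαQ⟩ := mem_lieGC_iff.1 hα
  set f := gradedMultiplier (D.bigrading F) ε α
  have hfW (k : ℤ) (v : V) (hv : v ∈ D.W k) : f v ∈ D.W k := hF.gradedMultiplier_mem_W ε hαW k hv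
  have hhom (k : ℤ) {a b : ℤ × ℤ} (ha : a.1 + a.2 ≤ k) (hb : b.1 + b.2 ≤ k) {u v : V}
      (hu : u ∈ D.bigrading F a) (hv : v ∈ D.bigrading F b) :
      D.form k (f u) v + D.form k u (f v) = 0 := by
    have huW : u ∈ D.W k := D.W_mono ha (I_le_W _ _ hu)
    have hvW : v ∈ D.W k := D.W_mono hb (I_le_W _ _ hv)
    obtain ha | ha := ha.lt_or_eq
    · have huW' : u ∈ D.W (k - 1) := D.W_mono (by lia) (I_le_W _ _ hu)
      rw [form_eq_zero_of_mem_left (hfW _ u huW') hvW,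
        form_eq_zero_of_mem_left huW' (hfW k v hvW), add_zero]
    obtain hb | hb := hb.lt_or_eq
    · have hvW' : v ∈ D.W (k - 1) := D.W_mono (by lia) (I_le_W _ _ hv)
      rw [form_eq_zero_of_mem_right (hfW k u huW) hvW',
        form_eq_zero_of_mem_right huW (hfW _ v hvW'), add_zero]
    have hdeg : b.swap - a = a.swap - b := by
      ext <;> simp only [Prod.fst_sub, Prod.snd_sub, Prod.fst_swap, Prod.snd_swap] <;> lia
    rw [form_symm (hfW k u huW) hvW, hQ.form_gradedMultiplier hF ε hαW hb ha hv hu, hdeg,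
      hQ.form_gradedMultiplier hF ε hαW ha hb hu hv, mul_left_comm,
      ← form_symm (hαW k u huW) hvW, ← mul_add, hαQ k u huW v hvW, mul_zero]
  refine mem_lieGC_iff.2 ⟨hfW, fun k u hu v hv => ?_⟩
  have hright (a : ℤ × ℤ) (ha : a.1 + a.2 ≤ k) (u : V) (hu : u ∈ D.bigrading F a) :
      D.W k ≤ (D.form k (f u) + (D.form k u).comp f).ker :=
    (hF.W_le_iSup_I k).trans (iSup₂_le fun b hb v hv => hhom k ha hb hu hv)
  have hleft : D.W k ≤ (((D.form k).flip v).comp f + (D.form k).flip (f v)).ker :=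
    (hF.W_le_iSup_I k).trans (iSup₂_le fun a ha u hu => hright a ha u hu hv)
  exact hleft hu

end Form

section LaxOperator

variable {V : Type*} [NormedAddCommGroup V] [NormedSpace ℂ V] {D : Data V} {F : Fil V}

/-- The multipliers by which `L` acts on the components of each degree. -/
def signL (r : ℤ × ℤ) : ℂ := if r.1 < 0 then -Complex.I else if r.2 < 0 then Complex.I else 0

theorem g_le_iSup {p : ℤ → ℤ → Prop} {r s : ℤ} (h : p r s) :
    D.g F r s ≤ ⨆ (r : ℤ) (s : ℤ) (_ : p r s), D.g F r s :=
  le_iSup_of_le r (le_iSup₂_of_le s h le_rfl)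

variable [FiniteDimensional ℂ V] [DirectSum.Decomposition (D.bigrading F)] {α : V →L[ℂ] V}

theorem gradedMultiplier_of_mem_g (ε : ℤ × ℤ → ℂ) {r s : ℤ} (hα : α ∈ D.g F r s) :
    gradedMultiplier (D.bigrading F) ε α = ε (r, s) • α :=
  gradedMultiplier_of_homogeneous (𝒱 := D.bigrading F) ε fun a v hv => hα.2 a.1 a.2 v hv

theorem IsIsotropic.gradedMultiplier_single_mem_g (hQ : D.IsIsotropic F) (hF : D.IsSplit F)
    (hα : α ∈ D.lieGC) (r : ℤ × ℤ) :
    gradedMultiplier (D.bigrading F) (Pi.single r 1) α ∈ D.g F r.1 r.2 :=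
  ⟨hQ.gradedMultiplier_mem_lieGC hF _ hα, fun p q _ hv =>
    gradedMultiplier_single_mem (𝒱 := D.bigrading F) α r (a := (p, q)) hv⟩

theorem IsMHS.gradedMultiplier_single_eq_zero (hF : D.IsMHS F) (hα : α ∈ D.lieGC) {r : ℤ × ℤ}
    (hr : 0 < r.1 + r.2) : gradedMultiplier (D.bigrading F) (Pi.single r 1) α = 0 := by
  refine eq_of_forall_gradedProj_apply_eq (𝒱 := D.bigrading F) fun a b v hv => ?_
  rw [gradedProj_gradedMultiplier _ α hv, zero_apply, map_zero]
  obtain rfl | hne := eq_or_ne (b - a) r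
  · simp only [Prod.fst_sub, Prod.snd_sub] at hr
    rw [hF.gradedProj_eq_zero_of_mem_W (hα.1 _ v (I_le_W _ _ hv)) (by lia), smul_zero]
  · rw [Pi.single_eq_of_ne hne, zero_smul]

theorem IsIsotropic.exists_isComponents (hQ : D.IsIsotropic F) (hF : D.IsSplit F)
    (hα : α ∈ D.lieGC) : ∃ t, D.IsComponents F α t := by
  classical
  let ind (P : ℤ × ℤ → Prop) (r : ℤ × ℤ) : ℂ := if P r then 1 else 0
  have hmem {P : ℤ × ℤ → Prop} {T : Submodule ℂ (V →L[ℂ] V)}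
      (hT : ∀ r, P r → gradedMultiplier (D.bigrading F) (Pi.single r 1) α ∈ T) :
      gradedMultiplier (D.bigrading F) (ind P) α ∈ T :=
    gradedMultiplier_mem_of_single_mem _ α fun r hr => hT r (by simpa [ind] using hr)
  have hg := hQ.gradedMultiplier_single_mem_g hF hα
  refine ⟨(gradedMultiplier (D.bigrading F) (ind fun r => 0 ≤ r.1 ∧ r.2 < 0) α,
    gradedMultiplier (D.bigrading F) (ind fun r => 0 ≤ r.1 ∧ 0 ≤ r.2) α,
    gradedMultiplier (D.bigrading F) (ind fun r => r.1 < 0) α), ?_, ?_, ?_, ?_⟩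
  · exact hmem fun r hr => g_le_iSup (p := fun r s => 0 ≤ r ∧ s < 0) hr (hg r)
  · refine hmem fun r hr => ?_
    obtain hr₀ | hr₀ := (add_nonneg hr.1 hr.2).eq_or_lt
    · obtain rfl : r = 0 := by
        ext <;> simp only [Prod.fst_zero, Prod.snd_zero] <;> lia
      exact hg 0
    · rw [hF.gradedMultiplier_single_eq_zero hα hr₀]
      exact zero_mem _
  · refine hmem fun r hr => ?_
    obtain hs | hs := lt_or_ge r.2 0
    · exact Submodule.mem_sup_right <|
        g_le_iSup (p := fun r s => r < 0 ∧ s < 0) ⟨hr, hs⟩ (hg r)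
    · exact Submodule.mem_sup_left <|
        g_le_iSup (p := fun r s => r < 0 ∧ 0 ≤ s) ⟨hr, hs⟩ (hg r)
  · have hone : (ind fun r => 0 ≤ r.1 ∧ r.2 < 0) + (ind fun r => 0 ≤ r.1 ∧ 0 ≤ r.2) +
        (ind fun r => r.1 < 0) = 1 := by
      funext r
      simp only [ind, Pi.add_apply, Pi.one_apply]
      split_ifs <;> first | lia | simp
    simp only [← LinearMap.add_apply, ← map_add, hone, gradedMultiplier_one]

theorem IsComponents.gradedMultiplier_signL
    {t : (V →L[ℂ] V) × (V →L[ℂ] V) × (V →L[ℂ] V)} (ht : D.IsComponents F α t) :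
    gradedMultiplier (D.bigrading F) signL α = Complex.I • t.1 - Complex.I • t.2.2 := by
  obtain ⟨hplus, hzero, hminus, rfl⟩ := ht
  set f := gradedMultiplier (D.bigrading F) signL
  have hg {c : ℂ} {r s : ℤ} (hc : signL (r, s) = c) : D.g F r s ≤ f.eqLocus (c • LinearMap.id) :=
    fun α hα => hc ▸ gradedMultiplier_of_mem_g signL hα
  have hplus_le : D.etaPlus F ≤ f.eqLocus (Complex.I • LinearMap.id) :=
    iSup_le fun r => iSup_le fun s => iSup_le fun h => hg (by simp [signL, h.1.not_gt, h.2])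
  have hminus_le : D.etaMinus F ⊔ D.Lam F ≤ f.eqLocus (-Complex.I • LinearMap.id) :=
    sup_le (iSup_le fun r => iSup_le fun s => iSup_le fun h => hg (by simp [signL, h.1]))
      (iSup_le fun r => iSup_le fun s => iSup_le fun h => hg (by simp [signL, h.1]))
  have hzero_le : D.etaZero F ≤ f.eqLocus ((0 : ℂ) • LinearMap.id) := hg (by simp [signL])
  have hplus_eq : f t.1 = Complex.I • t.1 := hplus_le hplus
  have hzero_eq : f t.2.1 = (0 : ℂ) • t.2.1 := hzero_le hzero
  have hminus_eq : f t.2.2 = -Complex.I • t.2.2 := hminus_le hminus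
  rw [map_add, map_add, hplus_eq, hzero_eq, hminus_eq, zero_smul, add_zero, neg_smul,
    sub_eq_add_neg]

theorem IsIsotropic.L_eq_gradedMultiplier (hQ : D.IsIsotropic F) (hF : D.IsSplit F)
    (hα : α ∈ D.lieGC) : D.L F α = gradedMultiplier (D.bigrading F) signL α := by
  have ht := hQ.exists_isComponents hF hα
  rw [L, dif_pos ht, IsComponents.gradedMultiplier_signL ht.choose_spec]

end LaxOperator

section LaxOperatorProperties

variable {V : Type*} [NormedAddCommGroup V] [NormedSpace ℂ V] [FiniteDimensional ℂ V] {D : Data V}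
  {F : Fil V}

theorem IsIsotropic.L_mem_lieH (hQ : D.IsIsotropic F) (hF : D.IsSplit F) {α : V →L[ℂ] V}
    (hα : α ∈ D.lieH) : D.L F α ∈ D.lieH := by
  let := hF.isInternal.chooseDecomposition
  have hsign (r : ℤ × ℤ) (hr : 0 ≤ r.1 ∨ 0 ≤ r.2) : starRingEnd ℂ (signL r.swap) = signL r := by
    simp only [signL, Prod.fst_swap, Prod.snd_swap]
    split_ifs <;> first | lia | simp
  rw [hQ.L_eq_gradedMultiplier hF hα.1]
  exact ⟨hQ.gradedMultiplier_mem_lieGC hF signL hα.1, fun k _ hv =>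
    hF.gradedMultiplier_conj_sub_mem hsign hα.2 k hv⟩

/-- The algebra of the operators which preserve every member of `F`. -/
def stabFil (F : Fil V) : Subalgebra ℝ (V →L[ℂ] V) where
  carrier := {a | ∀ p, ∀ v ∈ F p, a v ∈ F p}
  mul_mem' ha hb p v hv := ha p _ (hb p v hv)
  add_mem' ha hb p v hv := (F p).add_mem (ha p v hv) (hb p v hv)
  algebraMap_mem' c p _ hv := by
    rw [Algebra.algebraMap_eq_smul_one]
    exact (F p).smul_mem (c : ℂ) hv

theorem IsIsotropic.L_add_I_smul_mem_stabFil (hQ : D.IsIsotropic F) (hF : D.IsSplit F)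
    {α : V →L[ℂ] V} (hα : α ∈ D.lieGC) : D.L F α + Complex.I • α ∈ stabFil F := by
  let := hF.isInternal.chooseDecomposition
  have hmult : D.L F α + Complex.I • α =
      gradedMultiplier (D.bigrading F) (signL + Complex.I • 1) α := by
    rw [hQ.L_eq_gradedMultiplier hF hα, map_add, map_smul, LinearMap.add_apply,
      LinearMap.smul_apply, gradedMultiplier_one]
  have hdeg (r : ℤ × ℤ) (hr : (signL + Complex.I • 1) r ≠ 0) : 0 ≤ r.1 := by
    by_contra hneg
    exact hr (by simp [signL, not_le.1 hneg])
  rw [hmult]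
  exact fun p v hv => hF.gradedMultiplier_mem_F hdeg α hv

theorem IsIsotropic.continuousOn_L (hQ : D.IsIsotropic F) (hF : D.IsSplit F) {X : Type*}
    [TopologicalSpace X] {J : Set X} {β : X → V →L[ℂ] V} (hβ : ContinuousOn β J)
    (hβ' : ∀ y ∈ J, β y ∈ D.lieGC) : ContinuousOn (fun y => D.L F (β y)) J := by
  let := hF.isInternal.chooseDecomposition
  have hcont : Continuous (gradedMultiplier (D.bigrading F) signL) :=
    LinearMap.continuous_of_finiteDimensional _
  exact (hcont.comp_continuousOn hβ).congr fun y hy => hQ.L_eq_gradedMultiplier hF (hβ' y hy)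

end LaxOperatorProperties

section Groups

variable {V : Type*} [NormedAddCommGroup V] [NormedSpace ℂ V] {D : Data V} {F : Fil V}

/-- The algebra of the operators which preserve `W` and induce real endomorphisms of all the
quotients `W k / W (k - 2)`; its units include `H`. -/
def realAlgebra (D : Data V) : Subalgebra ℝ (V →L[ℂ] V) where
  carrier := {a | (∀ k, ∀ v ∈ D.W k, a v ∈ D.W k) ∧ ∀ k, a ∈ D.real (D.W k) (D.W (k - 2))}
  mul_mem' := by
    rintro a b ⟨ha, ha'⟩ ⟨hb, hb'⟩
    refine ⟨fun k v hv => ha k _ (hb k v hv), fun k v hv => ?_⟩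
    simpa using (D.W (k - 2)).add_mem (ha' k _ (hb k v hv)) (ha _ _ (hb' k v hv))
  add_mem' := by
    rintro a b ⟨ha, ha'⟩ ⟨hb, hb'⟩
    exact ⟨fun k v hv => add_mem (ha k v hv) (hb k v hv), fun k => add_mem (ha' k) (hb' k)⟩
  algebraMap_mem' c := by
    rw [Algebra.algebraMap_eq_smul_one]
    exact ⟨fun k v hv => (D.W k).smul_mem (c : ℂ) hv,
      fun k => Submodule.smul_mem _ c fun v _ => by simp⟩

theorem mem_realAlgebra_of_mem_lieH {α : V →L[ℂ] V} (hα : α ∈ D.lieH) : α ∈ D.realAlgebra :=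
  ⟨hα.1.1, hα.2⟩

theorem act_mul (g g' : V →L[ℂ] V) (F : Fil V) : act (g * g') F = act g (act g' F) :=
  funext fun p => Submodule.map_comp (g' : V →ₗ[ℂ] V) (g : V →ₗ[ℂ] V) (F p)

theorem map_eq_of_mapsTo {g : (V →L[ℂ] V)ˣ} {S : Submodule ℂ V}
    (hg : ∀ v ∈ S, (g : V →L[ℂ] V) v ∈ S) (hg' : ∀ v ∈ S, (↑g⁻¹ : V →L[ℂ] V) v ∈ S) :
    S.map ((g : V →L[ℂ] V) : V →ₗ[ℂ] V) = S :=
  le_antisymm (Submodule.map_le_iff_le_comap.2 hg) fun v hv =>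
    ⟨_, hg' v hv, DFunLike.congr_fun g.mul_inv v⟩

theorem act_eq_of_mem_stabFil {g : (V →L[ℂ] V)ˣ} (hg : (g : V →L[ℂ] V) ∈ stabFil F)
    (hg' : (↑g⁻¹ : V →L[ℂ] V) ∈ stabFil F) : act (g : V →L[ℂ] V) F = F :=
  funext fun p => map_eq_of_mapsTo (hg p) (hg' p)

variable [FiniteDimensional ℂ V]

theorem mem_H_of_mem_realAlgebra {g : (V →L[ℂ] V)ˣ} (hg : (g : V →L[ℂ] V) ∈ D.realAlgebra)
    (hg' : (↑g⁻¹ : V →L[ℂ] V) ∈ D.realAlgebra)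
    (hQ : ∀ k, ∀ v ∈ D.W k, ∀ w ∈ D.W k,
      D.form k ((g : V →L[ℂ] V) v) ((g : V →L[ℂ] V) w) = D.form k v w) : g ∈ D.H := by
  refine ⟨⟨⟨fun k => map_eq_of_mapsTo (hg.1 k) (hg'.1 k), fun k u v u' v' hu hv => ?_⟩,
    fun k v hv => D.W_mono (by lia) (hg.2 k v hv)⟩, hg.2⟩
  rw [← form_eq_Q, ← form_eq_Q, hu, hv, hQ k u u.2 v v.2]

variable {J : Set ℝ} {t₀ t : ℝ} {a : ℝ → V →L[ℂ] V} {u : ℝ → (V →L[ℂ] V)ˣ}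

theorem form_fundamentalSolution (hJ : IsOpen J) (hJ' : J.OrdConnected) (ht₀ : t₀ ∈ J)
    (hu : IsFundamentalSolution J t₀ a u) (ha : ∀ t ∈ J, a t ∈ D.lieGC) {k : ℤ}
    (huW : ∀ t, ∀ v ∈ D.W k, (u t : V →L[ℂ] V) v ∈ D.W k) {v w : V} (hv : v ∈ D.W k)
    (hw : w ∈ D.W k) (ht : t ∈ J) :
    D.form k ((u t : V →L[ℂ] V) v) ((u t : V →L[ℂ] V) w) = D.form k v w := by
  have happly (z : V) (s : ℝ) (hs : s ∈ J) : HasDerivAt (fun s => (u s : V →L[ℂ] V) z)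
      (a s ((u s : V →L[ℂ] V) z)) s :=
    ((ContinuousLinearMap.apply ℂ V z).restrictScalars ℝ).hasFDerivAt.comp_hasDerivAt s
      (hu.hasDerivAt s hs)
  have hderiv (s : ℝ) (hs : s ∈ J) : HasDerivAt
      (fun s => D.form k ((u s : V →L[ℂ] V) v) ((u s : V →L[ℂ] V) w)) 0 s := by
    refine (((D.form k).bilinearRestrictScalars ℝ).hasDerivAt_of_bilinear
      (fun _ => happly v s hs) (fun _ => happly w s hs)).congr_deriv ?_
    rw [add_comm]
    exact (mem_lieGC_iff.1 (ha s hs)).2 k _ (huW s v hv) _ (huW s w hw)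
  simpa [hu.map_init] using eq_of_hasDerivAt_zero hJ hJ' hderiv ht ht₀

theorem inv_fundamentalSolution_mem_H (hJ : IsOpen J) (hJ' : J.OrdConnected) (ht₀ : t₀ ∈ J)
    (hu : IsFundamentalSolution J t₀ a u) (ha : ∀ t ∈ J, a t ∈ D.lieGC)
    (huS : ∀ t, (u t : V →L[ℂ] V) ∈ D.realAlgebra ∧ (↑(u t)⁻¹ : V →L[ℂ] V) ∈ D.realAlgebra)
    (ht : t ∈ J) : (u t)⁻¹ ∈ D.H := by
  refine mem_H_of_mem_realAlgebra (huS t).2 (by simpa using (huS t).1) fun k v hv w hw => ?_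
  have hinv (z : V) : (u t : V →L[ℂ] V) ((↑(u t)⁻¹ : V →L[ℂ] V) z) = z :=
    DFunLike.congr_fun (u t).mul_inv z
  simpa only [hinv] using (form_fundamentalSolution hJ hJ' ht₀ hu ha (fun t => (huS t).1.1 k)
    ((huS t).2.1 k v hv) ((huS t).2.1 k w hw) ht).symm

theorem exists_mem_GC_eq_exp {α : V →L[ℂ] V} (hα : α ∈ D.lieGC) :
    ∃ g ∈ D.GC, (g : V →L[ℂ] V) = NormedSpace.exp α := by
  simpa only [one_smul] using (D.mem_lieGC_iff_exp α).1 hα 1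

theorem self_mem_Mcheck : F ∈ D.Mcheck F := by
  obtain ⟨g, hg, hgexp⟩ := exists_mem_GC_eq_exp (D := D) D.lieGC.zero_mem
  refine ⟨g, hg, ?_⟩
  rw [hgexp, NormedSpace.exp_zero]
  exact (funext fun p => Submodule.map_id (F p)).symm

theorem IsIsotropic.exists_act_inv_eq_act_exp (hQ : D.IsIsotropic F) (hF : D.IsSplit F)
    (hJ : IsOpen J) (hJ' : J.OrdConnected) (ht₀ : t₀ ∈ J) {β : ℝ → V →L[ℂ] V}
    (hβ : ContinuousOn β J) (hβ' : ∀ t ∈ J, β t ∈ D.lieGC)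
    (hu : IsFundamentalSolution J t₀ (fun t => D.L F (β t)) u) {N : V →L[ℂ] V}
    (huN : ∀ t ∈ J, ↑(u t)⁻¹ * β t * u t = N) :
    ∃ F' ∈ D.Mcheck F, ∀ t ∈ J, act (↑(u t)⁻¹ : V →L[ℂ] V) F =
      act (NormedSpace.exp ((Complex.I * (t : ℂ)) • N)) F' := by
  have : FiniteDimensional ℝ (V →L[ℂ] V) := FiniteDimensional.complexToReal _
  have : CompleteSpace (V →L[ℂ] V) := FiniteDimensional.complete ℂ _
  obtain ⟨x, hx, hxF⟩ := exists_isFundamentalSolution_mem hJ hJ' ht₀ (stabFil F)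
    ((hQ.continuousOn_L hF hβ hβ').add (hβ.const_smul Complex.I))
    fun t ht => hQ.L_add_I_smul_mem_stabFil hF (hβ' t ht)
  have hN : N ∈ D.lieGC := by
    rw [← huN t₀ ht₀, hu.map_init, inv_one, Units.val_one, one_mul, mul_one]
    exact hβ' t₀ ht₀
  obtain ⟨g, hg, hgexp⟩ := exists_mem_GC_eq_exp (D.lieGC.smul_mem (-(Complex.I * (t₀ : ℂ))) hN)
  refine ⟨act g F, ⟨g, hg, rfl⟩, fun t ht => ?_⟩
  have hexp : (↑((u t)⁻¹ * x t) : V →L[ℂ] V) =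
      NormedSpace.exp ((Complex.I * (t : ℂ)) • N) * g := by
    have hconst (s : ℝ) (hs : s ∈ J) : ↑(u s)⁻¹ * Complex.I • β s * u s = Complex.I • N := by
      rw [mul_smul_comm, smul_mul_assoc, huN s hs]
    have hcoeff : (t - t₀) • Complex.I • N =
        (Complex.I * (t : ℂ)) • N + (-(Complex.I * (t₀ : ℂ))) • N := by
      rw [← Complex.coe_smul, smul_smul, ← add_smul]
      push_cast
      ring_nf
    let : NormedAlgebra ℚ (V →L[ℂ] V) := NormedAlgebra.restrictScalars ℚ ℂ _
    rw [(hu.inv_mul hx).eq_exp hJ hJ' ht₀ hconst ht, hcoeff, hgexp,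
      NormedSpace.exp_add_of_commute (((Commute.refl N).smul_left _).smul_right _)]
  calc act (↑(u t)⁻¹ : V →L[ℂ] V) F
      = act (↑(u t)⁻¹ : V →L[ℂ] V) (act (x t : V →L[ℂ] V) F) := by
        rw [act_eq_of_mem_stabFil (hxF t).1 (hxF t).2]
    _ = act (NormedSpace.exp ((Complex.I * (t : ℂ)) • N)) (act g F) := by
        rw [← act_mul, ← act_mul, ← hexp, Units.val_mul]

end Groups

end MixedHodge.Data

end

theorem theorem7p1_general {V : Type*} [NormedAddCommGroup V] [NormedSpace ℂ V]
    [FiniteDimensional ℂ V] (D : MixedHodge.Data V) (F₀ : MixedHodge.Fil V) (hF₀ : D.IsSplit F₀)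
    (hQ : D.IsIsotropic F₀) (J : Set ℝ) (hJ : IsOpen J) (hJ' : J.OrdConnected)
    (β : ℝ → V →L[ℂ] V) (hβ : ∀ y ∈ J, β y ∈ D.lieH)
    (hLax : ∀ y ∈ J, HasDerivAt β (-⁅β y, D.L F₀ (β y)⁆) y) :
    ∃ (h : ℝ → (V →L[ℂ] V)ˣ) (N : V →L[ℂ] V) (F : MixedHodge.Fil V),
      (∀ y ∈ J, h y ∈ D.H) ∧ N ∈ D.lieH ∧ F ∈ D.Mcheck F₀ ∧
      (∀ y ∈ J, DifferentiableAt ℝ (fun t => (h t : V →L[ℂ] V)) y ∧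
        ((h y)⁻¹ : (V →L[ℂ] V)ˣ) * deriv (fun t => (h t : V →L[ℂ] V)) y = -D.L F₀ (β y)) ∧
      (∀ y ∈ J, β y = ((h y)⁻¹ : (V →L[ℂ] V)ˣ) * N * (h y : V →L[ℂ] V)) ∧
      (∀ y ∈ J, MixedHodge.act (h y : V →L[ℂ] V) F₀ =
        MixedHodge.act (NormedSpace.exp ((Complex.I * (y : ℂ)) • N)) F) := by
  have : FiniteDimensional ℝ (V →L[ℂ] V) := FiniteDimensional.complexToReal _
  have : CompleteSpace (V →L[ℂ] V) := FiniteDimensional.complete ℂ _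
  obtain rfl | ⟨y₀, hy₀⟩ := J.eq_empty_or_nonempty
  · exact ⟨1, 0, F₀, by simp, zero_mem _, MixedHodge.Data.self_mem_Mcheck, by simp, by simp,
      by simp⟩
  have hβ' (y : ℝ) (hy : y ∈ J) : β y ∈ D.lieGC := (hβ y hy).1
  have hβc : ContinuousOn β J := fun y hy => (hLax y hy).continuousAt.continuousWithinAt
  have hLc := hQ.continuousOn_L hF₀ hβc hβ'
  have hLH (y : ℝ) (hy : y ∈ J) : D.L F₀ (β y) ∈ D.lieH := hQ.L_mem_lieH hF₀ (hβ y hy)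
  obtain ⟨u, hu, huH⟩ := exists_isFundamentalSolution_mem hJ hJ' hy₀ D.realAlgebra hLc
    fun y hy => MixedHodge.Data.mem_realAlgebra_of_mem_lieH (hLH y hy)
  have hiso (y : ℝ) (hy : y ∈ J) : ↑(u y)⁻¹ * β y * u y = β y₀ :=
    hu.inv_mul_mul_eq hJ hJ' hy₀
      (fun y hy => (hLax y hy).congr_deriv (by simp only [Ring.lie_def, neg_sub])) hy
  obtain ⟨F, hF, hact⟩ := hQ.exists_act_inv_eq_act_exp hF₀ hJ hJ' hy₀ hβc hβ' hu hiso
  refine ⟨fun y => (u y)⁻¹, β y₀, F, fun y hy => ?_, hβ y₀ hy₀, hF, fun y hy => ?_, fun y hy => ?_,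
    hact⟩
  · exact MixedHodge.Data.inv_fundamentalSolution_mem_H hJ hJ' hy₀ hu (fun y hy => (hLH y hy).1)
      huH hy
  · have hder := hu.hasDerivAt_inv hy
    exact ⟨hder.differentiableAt, by rw [hder.deriv, inv_inv, mul_neg, Units.mul_inv_cancel_left]⟩
  · simp [← hiso y hy, mul_assoc]

theorem theorem7p1 {V : Type*} [NormedAddCommGroup V] [NormedSpace ℂ V] [FiniteDimensional ℂ V]
    (D : MixedHodge.Data V) (hn : ℤ → ℤ → ℕ) (F₀ : MixedHodge.Fil V) (hF₀ : F₀ ∈ D.MR hn)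
    (J : Set ℝ) (hJ : IsOpen J) (hJ' : J.OrdConnected)
    (β : ℝ → V →L[ℂ] V) (hβ : ∀ y ∈ J, β y ∈ D.lieH)
    (hLax : ∀ y ∈ J, HasDerivAt β (-⁅β y, D.L F₀ (β y)⁆) y) :
    ∃ (h : ℝ → (V →L[ℂ] V)ˣ) (N : V →L[ℂ] V) (F : MixedHodge.Fil V),
      (∀ y ∈ J, h y ∈ D.H) ∧ N ∈ D.lieH ∧ F ∈ D.Mcheck F₀ ∧
      (∀ y ∈ J, DifferentiableAt ℝ (fun t => (h t : V →L[ℂ] V)) y ∧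
        ((h y)⁻¹ : (V →L[ℂ] V)ˣ) * deriv (fun t => (h t : V →L[ℂ] V)) y = -D.L F₀ (β y)) ∧
      (∀ y ∈ J, β y = ((h y)⁻¹ : (V →L[ℂ] V)ˣ) * N * (h y : V →L[ℂ] V)) ∧
      (∀ y ∈ J, MixedHodge.act (h y : V →L[ℂ] V) F₀ =
        MixedHodge.act (NormedSpace.exp ((Complex.I * (y : ℂ)) • N)) F) :=
  theorem7p1_general D F₀ ⟨hF₀.1.1, hF₀.2⟩ hF₀.1.2.1.orthogonal J hJ hJ' β hβ hLax
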